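/- Let $a,b>0$. Let $T$ be the tree with the twelve vertices $A,\dots,L$ and the eleven edges $AB$ (length $a$), $AC$, $AI$ (length $a+b$), $BD$, $BH$, $DG$, $HL$, $CF$, $IK$, $EF$, $JK$ (length $b$). Place all vertices on a vertical line: $A$ at the top, at height $a+b$; $B,F,G,K,L$ at the center, at height $b$; $C,D,E,H,I,J$ at the bottom, at height $0$. Let overlapping edges be ordered from left to right as in the list $AC, BD, EF, DG, CF, AB, IK, HL, JK, BH, AI$ (so the figure is symmetric under the reflection fixing $A,B$ and exchanging $C,D,E,F,G$ with $I,H,J,K,L$). Here self-touching configurations are understood as follows. A drawing $p$ of $T$ assigns to each vertex $v$ a point $p(v)\in\mathbb{C}$; it is nontouching if $p$ is injective and two distinct edges meet only at a shared vertex. Its side annotation assigns to an ordered pair $(e,f)$ of distinct oriented edges, $e=(x,y)$, $f=(r,s)$, the number $\int_0^1\arg\frac{p(s)-z_t}{p(r)-z_t}\,dt$ with $z_t=(1-t)p(x)+t\,p(y)$ and $\arg\in(-\pi,\pi]$ (and $0$ if $e$ and $f$ are the same edge up to orientation). For nontouching drawings it is continuous; at an overlap of positive length its limit is discontinuous and records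 on which side of $f$ the edge $e$ lies. A self-touching configuration of the linkage is a drawing with the prescribed edge lengths, together with a real number for each ordered pair of oriented edges, that is a limit of nontouching drawings of $T$ (of arbitrary edge lengths) with their side annotations. A motion is a continuous path $\gamma:[0,1]\to\{\text{self-touching configurations}\}$, and a self-touching configuration $c$ is rigid if for every motion $\gamma$ with $\gamma(0)=c$ and every $t$, $\gamma(t)$ is the image of $c$ under a rigid motion $z\mapsto uz+w$, $|u|=1$, of the plane, with the same annotation. Theorem. The vertical placement above, with annotations given by its left-to-right order (for distinct edges $e,f$: absolute value $\pi$ times the fraction of $e$ covered by $f$, positive if $e$ lies on the left side of the oriented edge $f$, negative if on its right side), is a self-touching configuration of this linkage, and it is rigid. -/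

import Mathlib

noncomputable section

namespace SelfTouching

/-- A planar linkage without zero-length edges: a simple graph with a positive length on each edge.
(The combinatorial embedding is not a separate field: at a configuration, self-touching or not, it
is determined by the positions and the side annotations below.  No condition on it is imposed on
motions.) -/
structure Linkage (V : Type*) where
  graph : SimpleGraph V
  length : Sym2 V → ℝ
  length_pos : ∀ e ∈ graph.edgeSet, 0 < length e

variable {V : Type*}

/-- A straight-line drawing of a graph in the plane `ℂ` (given by the positions of the vertices) is
nontouching if distinct vertices have distinct positions and no two distinct edges meet except at
a shared vertex. -/
def IsNontouching (G : SimpleGraph V) (p : V → ℂ) : Prop :=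
  Function.Injective p ∧
    ∀ e f : G.Dart, e.edge ≠ f.edge →
      ∀ z ∈ segment ℝ (p e.fst) (p e.snd) ∩ segment ℝ (p f.fst) (p f.snd),
        ∃ v : V, v ∈ e.edge ∧ v ∈ f.edge ∧ p v = z

/-- The signed angle, in `(-π, π]`, under which the oriented segment from `r` to `s` is seen from
the point `z` (positive if the turn from `r` to `s` is counterclockwise).  As `z` approaches an
interior point of the segment, it tends to `π` from the left side of the oriented segment, and to
`-π` from its right side. -/
def viewAngle (z r s : ℂ) : ℝ := Complex.arg ((s - z) / (r - z))

/-- The side annotation of the ordered pair of oriented edges `(e, f)` of a drawing: the average,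
over the points `z` of `e`, of the signed angle under which `f` is seen from `z`.
It depends continuously on the drawing except where `e` and `f` overlap in a segment of positive
length; near such a drawing, the overlap contributes `π` times the overlapping fraction of `e` if
`e` is on the left side of `f`, and the negative of this if `e` is on the right side of `f`. -/
def sideAnnotation (G : SimpleGraph V) (p : V → ℂ) (e f : G.Dart) : ℝ :=
  open Classical in
  if e.edge = f.edge then 0
  else ∫ t in (0 : ℝ)..1,
    viewAngle (AffineMap.lineMap (p e.fst) (p e.snd) t) (p f.fst) (p f.snd)

/-- An annotated drawing: positions of the vertices, together with a real number for each ordered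
pair of oriented edges.  It carries the product topology. -/
abbrev AnnotatedDrawing (G : SimpleGraph V) : Type _ :=
  (V → ℂ) × (G.Dart → G.Dart → ℝ)

/-- A drawing together with its own side annotations. -/
def annotate (G : SimpleGraph V) (p : V → ℂ) : AnnotatedDrawing G :=
  (p, sideAnnotation G p)

namespace Linkage

/-- The positions `p` realize the edge lengths of the linkage. -/
def Realizes (L : Linkage V) (p : V → ℂ) : Prop :=
  ∀ u v : V, L.graph.Adj u v → dist (p u) (p v) = L.length s(u, v)

/-- The space of self-touching configurations of `L`: the annotated drawings with the edge lengths
of `L` which are limits of annotated nontouching drawings of the graph of `L` (drawings whose edge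
lengths need only converge to those of `L`). -/
def selfTouchingSpace (L : Linkage V) : Set (AnnotatedDrawing L.graph) :=
  {c | L.Realizes c.1 ∧ c ∈ closure (annotate L.graph '' {q | IsNontouching L.graph q})}

/-- A motion of the self-touching configuration `c`: a path in the space of self-touching
configurations, starting at `c`, along which positions and annotations vary continuously. -/
def IsMotion (L : Linkage V) (c : AnnotatedDrawing L.graph)
    (γ : unitInterval → AnnotatedDrawing L.graph) : Prop :=
  Continuous γ ∧ γ 0 = c ∧ ∀ t, γ t ∈ L.selfTouchingSpace

/-- `c'` is the image of `c` under a rigid motion `z ↦ u * z + w` of the plane, where `‖u‖ = 1`.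
Side annotations are invariant under rigid motions. -/
def IsRigidImage {G : SimpleGraph V} (c c' : AnnotatedDrawing G) : Prop :=
  ∃ u w : ℂ, ‖u‖ = 1 ∧ (∀ v, c'.1 v = u * c.1 v + w) ∧ c'.2 = c.2

/-- A self-touching configuration is rigid if it has no motion other than rigid motions. -/
def IsRigid (L : Linkage V) (c : AnnotatedDrawing L.graph) : Prop :=
  ∀ γ : unitInterval → AnnotatedDrawing L.graph, L.IsMotion c γ → ∀ t, IsRigidImage c (γ t)

end Linkage

/-- The twelve vertices of the tree.  The tree is symmetric under the reflection that fixes `A`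
and `B` and exchanges `C, D, E, F, G` with `I, H, J, K, L`, in this order. -/
inductive TreeVertex
  | A | B | C | D | E | F | G | H | I | J | K | L
  deriving DecidableEq

open TreeVertex

/-- The eleven edges of the tree, listed from left to right: whenever two edges overlap in the
self-touching configuration, the one that comes first in this list is on the left. -/
def treeEdges : List (Sym2 TreeVertex) :=
  [s(A, C), s(B, D), s(E, F), s(D, G), s(C, F), s(A, B),
    s(I, K), s(H, L), s(J, K), s(B, H), s(A, I)]

/-- The tree. -/
def treeGraph : SimpleGraph TreeVertex :=
  SimpleGraph.fromEdgeSet {e | e ∈ treeEdges}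

/-- The edge lengths of the tree: `a` for `AB`, `a + b` for `AC` and `AI`, and `b` for the
other eight edges. -/
def treeLength (a b : ℝ) (e : Sym2 TreeVertex) : ℝ :=
  if e = s(A, B) then a else if e = s(A, C) ∨ e = s(A, I) then a + b else b

/-- The tree linkage. -/
def treeLinkage (a b : ℝ) (ha : 0 < a) (hb : 0 < b) : Linkage TreeVertex where
  graph := treeGraph
  length := treeLength a b
  length_pos := by
    intro e _
    unfold treeLength
    split_ifs <;> linarith

/-- The heights of the vertices: `A` is at the top, at height `a + b`; `B, F, G, K, L` are at the
center, at height `b`; and `C, D, E, H, I, J` are at the bottom, at height `0`. -/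
def treeHeight (a b : ℝ) : TreeVertex → ℝ
  | A => a + b
  | B | F | G | K | L => b
  | C | D | E | H | I | J => 0

/-- The length of the overlap of the (vertical) edges `e` and `f` when all vertices are placed on
a vertical line at their heights. -/
def treeOverlap (a b : ℝ) (e f : treeGraph.Dart) : ℝ :=
  max 0
    (min (max (treeHeight a b e.fst) (treeHeight a b e.snd))
        (max (treeHeight a b f.fst) (treeHeight a b f.snd)) -
      max (min (treeHeight a b e.fst) (treeHeight a b e.snd))
        (min (treeHeight a b f.fst) (treeHeight a b f.snd)))

/-- The side annotations of the self-touching tree.  For distinct edges the absolute value is `π`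
times the fraction of `e` covered by `f`; the sign is positive if `e` is on the left side of the
oriented edge `f`, that is, if `e` is to the left of `f` and `f` points upwards, or `e` is to the
right of `f` and `f` points downwards. -/
def treeAnnotation (a b : ℝ) (e f : treeGraph.Dart) : ℝ :=
  if e.edge = f.edge then 0
  else
    (if treeEdges.idxOf e.edge < treeEdges.idxOf f.edge then 1 else -1) *
      (if treeHeight a b f.fst < treeHeight a b f.snd then 1 else -1) *
      (Real.pi * (treeOverlap a b e f / treeLength a b e.edge))

/-- The self-touching tree: all vertices on the imaginary axis at their heights, with the edges
ordered from left to right as in `treeEdges`. -/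
def selfTouchingTree (a b : ℝ) : AnnotatedDrawing treeGraph :=
  (fun v => (treeHeight a b v : ℂ) * Complex.I, treeAnnotation a b)

end SelfTouching

end

/-!
The self-touching tree is a limit of nontouching drawings, which are written down explicitly, and it
is rigid because all self-touching configurations close to it are rigid images of it.

*Annotations and sides.*  Near the vertical placement, the annotation of two overlapping edges of a
nontouching drawing is close to `π` or `-π` times the overlapping fraction, with the sign given by
the side on which the first edge lies (`tendsto_sideAnnotation`).  Hence the annotations of a nearby
nontouching drawing force every overlapping edge to its prescribed side (`eventually_onSide`).

*Wedges.*  If an edge is to the right of one arm and to the left of the other arm of a narrow wedge,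
then its end is inside the wedge (`sub_mem_upCone_of_trapped`).  So `E` is in the wedge `B D G`, `F`
is in the wedge `D B H`, `G` is in the wedge `E F C`, and `D` is in the wedge `A C F`, and likewise
in the right half of the tree.  These conditions say that a difference of two positions lies in a
closed cone around the upward direction, so they hold for limits of nontouching drawings as well.

*Lengths.*  If `u` and `v` are in the cone, `u` rises less than `v`, and `v - u` is as long as `v`,
then `u = 0` (`eq_zero_of_norm_sub_eq`).  Since `F - E = (B - D) - ((E - D) + (B - F))` is as long
as `B - D`, this gives `E = D` and `F = B`.  Since `D G` is as long as `D B`, it gives `G = B`.  Now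
`C` is at distance `b` from `F = B` and at distance `a + b` from `A`, while `B` is at distance `a`
from `A`; so `A`, `B`, `C` are on a line, and `C` is determined by `A` and `B`.  Finally `B D` is as
long as `B C`, which gives `D = C` (`hook_positions`).

*Conclusion.*  Nearby configurations therefore have the positions of a rigid image of the tree, and
the annotations too, as these are determined by the sides.  The set of times at which a motion is at
a rigid image of the tree is closed, and it is open by the above, so it is the whole interval.
-/

namespace SelfTouching

open Filter Topology MeasureTheory TreeVertex

/-! ### The view angle and its limits -/

/-- Twice the signed area of the triangle `p q z`: it is positive if `z` lies to the left of the
line from `p` to `q`, and negative if `z` lies to the right of it. -/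
def signedArea (p q z : ℂ) : ℝ :=
  (q.re - p.re) * (z.im - p.im) - (q.im - p.im) * (z.re - p.re)

theorem im_div_eq_signedArea (p q z : ℂ) :
    ((q - z) / (p - z)).im = signedArea p q z / Complex.normSq (p - z) := by
  rw [Complex.div_im, signedArea, ← sub_div]
  simp only [Complex.sub_re, Complex.sub_im]
  ring

theorem signedArea_neg (p q z : ℂ) : signedArea (-p) (-q) (-z) = signedArea p q z := by
  simp only [signedArea, Complex.neg_re, Complex.neg_im]
  ring

theorem lineMap_re (p q : ℂ) (t : ℝ) :
    (AffineMap.lineMap p q t : ℂ).re = AffineMap.lineMap p.re q.re t := by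
  simp [AffineMap.lineMap_apply]

theorem lineMap_im (p q : ℂ) (t : ℝ) :
    (AffineMap.lineMap p q t : ℂ).im = AffineMap.lineMap p.im q.im t := by
  simp [AffineMap.lineMap_apply]

theorem lineMap_real (r s t : ℝ) : AffineMap.lineMap r s t = (s - r) * t + r := by
  simp [AffineMap.lineMap_apply]; ring

theorem abs_viewAngle_le (z r s : ℂ) : |viewAngle z r s| ≤ Real.pi := Complex.abs_arg_le_pi _

theorem measurable_viewAngle_lineMap (r s p q : ℂ) :
    Measurable fun t : ℝ => viewAngle (AffineMap.lineMap r s t) p q := by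
  have h : Measurable fun t : ℝ => (AffineMap.lineMap r s t : ℂ) :=
    (AffineMap.lineMap_continuous (R := ℝ) (p := r) (q := s)).measurable
  exact Complex.measurable_arg.comp ((measurable_const.sub h).div (measurable_const.sub h))

/-- If `z` approaches a point of the imaginary axis outside the limit of the segment from `p` to
`q`, then the segment is seen from `z` under an angle that tends to `0`. -/
theorem tendsto_viewAngle_of_notMem {ι : Type*} {l : Filter ι} {P Q Z : ι → ℂ} {p q z : ℝ}
    (hP : Tendsto P l (𝓝 (p * Complex.I))) (hQ : Tendsto Q l (𝓝 (q * Complex.I)))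
    (hZ : Tendsto Z l (𝓝 (z * Complex.I))) (h : z < min p q ∨ max p q < z) :
    Tendsto (fun n => viewAngle (Z n) (P n) (Q n)) l (𝓝 0) := by
  have hpz : p - z ≠ 0 := by
    rcases h with h | h
    · exact sub_ne_zero.2 (lt_min_iff.1 h).1.ne'
    · exact sub_ne_zero.2 (max_lt_iff.1 h).1.ne
  have hpos : 0 < (q - z) / (p - z) := by
    rcases h with h | h
    · rw [lt_min_iff] at h
      exact div_pos (by linarith) (by linarith)
    · rw [max_lt_iff] at h
      exact div_pos_of_neg_of_neg (by linarith) (by linarith)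
  have hlim : Tendsto (fun n => (Q n - Z n) / (P n - Z n)) l (𝓝 (((q - z) / (p - z) : ℝ) : ℂ)) := by
    have h0 : (p * Complex.I - z * Complex.I) ≠ 0 := by
      rw [← sub_mul]; exact mul_ne_zero (by exact_mod_cast hpz) Complex.I_ne_zero
    have := (hQ.sub hZ).div (hP.sub hZ) h0
    rwa [← sub_mul, ← sub_mul, mul_div_mul_right _ _ Complex.I_ne_zero, ← Complex.ofReal_sub,
      ← Complex.ofReal_sub, ← Complex.ofReal_div] at this
  have := (Complex.continuousAt_arg (Complex.ofReal_mem_slitPlane.2 hpos)).tendsto.comp hlim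
  rwa [Complex.arg_ofReal_of_nonneg hpos.le] at this

/-- If `z` approaches an interior point of the limit of the segment from `p` to `q`, staying on one
side of it, then the segment is seen from `z` under an angle that tends to `π` or `-π`. -/
theorem tendsto_viewAngle_of_mem {ι : Type*} {l : Filter ι} {P Q Z : ι → ℂ} {p q z σ : ℝ}
    (hP : Tendsto P l (𝓝 (p * Complex.I))) (hQ : Tendsto Q l (𝓝 (q * Complex.I)))
    (hZ : Tendsto Z l (𝓝 (z * Complex.I))) (h : z ∈ Set.Ioo (min p q) (max p q))
    (hσ : σ = 1 ∨ σ = -1) (hside : ∀ᶠ n in l, 0 < σ * signedArea (P n) (Q n) (Z n)) :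
    Tendsto (fun n => viewAngle (Z n) (P n) (Q n)) l (𝓝 (σ * Real.pi)) := by
  obtain ⟨hpz, hneg⟩ : p - z ≠ 0 ∧ (q - z) / (p - z) < 0 := by
    obtain ⟨h1, h2⟩ := h
    rcases le_total p q with hpq | hpq
    · rw [min_eq_left hpq] at h1
      rw [max_eq_right hpq] at h2
      exact ⟨sub_ne_zero.2 h1.ne, div_neg_of_pos_of_neg (by linarith) (by linarith)⟩
    · rw [min_eq_right hpq] at h1
      rw [max_eq_left hpq] at h2
      exact ⟨sub_ne_zero.2 h2.ne', div_neg_of_neg_of_pos (by linarith) (by linarith)⟩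
  have hlim : Tendsto (fun n => (Q n - Z n) / (P n - Z n)) l (𝓝 (((q - z) / (p - z) : ℝ) : ℂ)) := by
    have h0 : (p * Complex.I - z * Complex.I) ≠ 0 := by
      rw [← sub_mul]; exact mul_ne_zero (by exact_mod_cast hpz) Complex.I_ne_zero
    have := (hQ.sub hZ).div (hP.sub hZ) h0
    rwa [← sub_mul, ← sub_mul, mul_div_mul_right _ _ Complex.I_ne_zero, ← Complex.ofReal_sub,
      ← Complex.ofReal_sub, ← Complex.ofReal_div] at this
  have hne : ∀ n, 0 < σ * signedArea (P n) (Q n) (Z n) → 0 < Complex.normSq (P n - Z n) := by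
    intro n hn
    refine Complex.normSq_pos.2 fun h0 => ?_
    rw [sub_eq_zero] at h0
    simp [signedArea, h0] at hn
  rcases hσ with rfl | rfl
  · have hw : Tendsto (fun n => (Q n - Z n) / (P n - Z n)) l
        (𝓝[{w : ℂ | 0 ≤ w.im}] (((q - z) / (p - z) : ℝ) : ℂ)) := by
      refine tendsto_nhdsWithin_iff.2 ⟨hlim, hside.mono fun n hn => ?_⟩
      have := hne n hn
      rw [Set.mem_ofPred_eq, im_div_eq_signedArea]
      rw [one_mul] at hn
      positivity
    rw [one_mul]
    exact (Complex.tendsto_arg_nhdsWithin_im_nonneg_of_re_neg_of_im_zero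
      (by rwa [Complex.ofReal_re]) (Complex.ofReal_im _)).comp hw
  · have hw : Tendsto (fun n => (Q n - Z n) / (P n - Z n)) l
        (𝓝[{w : ℂ | w.im < 0}] (((q - z) / (p - z) : ℝ) : ℂ)) := by
      refine tendsto_nhdsWithin_iff.2 ⟨hlim, hside.mono fun n hn => ?_⟩
      have := hne n hn
      rw [Set.mem_ofPred_eq, im_div_eq_signedArea]
      exact div_neg_of_neg_of_pos (by linarith) this
    rw [neg_one_mul]
    exact (Complex.tendsto_arg_nhdsWithin_im_neg_of_re_neg_of_im_zero
      (by rwa [Complex.ofReal_re]) (Complex.ofReal_im _)).comp hw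

theorem integral_indicator_lineMap {r s : ℝ} (p q c : ℝ) (hrs : r ≠ s) :
    ∫ t in (0 : ℝ)..1, (Set.Ioc (min p q) (max p q)).indicator (fun _ => c)
        (AffineMap.lineMap r s t) =
      c * (max 0 (min (max r s) (max p q) - max (min r s) (min p q)) / |r - s|) := by
  have key : ∀ x y : ℝ, x ≤ y → ∫ u in x..y, (Set.Ioc (min p q) (max p q)).indicator (fun _ => c) u
      = c * max 0 (min y (max p q) - max x (min p q)) := by
    intro x y hxy
    rw [intervalIntegral.integral_of_le hxy, setIntegral_indicator measurableSet_Ioc,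
      Set.Ioc_inter_Ioc, setIntegral_const, Real.volume_real_Ioc, smul_eq_mul, max_comm, mul_comm]
  simp_rw [lineMap_real]
  rw [intervalIntegral.integral_comp_mul_add _ (sub_ne_zero.2 hrs.symm)]
  simp only [mul_zero, zero_add, mul_one, sub_add_cancel, smul_eq_mul]
  rcases hrs.lt_or_gt with h | h
  · rw [key r s h.le, max_eq_right h.le, min_eq_left h.le, abs_of_neg (by linarith), neg_sub]
    field_simp
  · rw [intervalIntegral.integral_symm, key s r h.le, max_eq_left h.le, min_eq_right h.le,
      abs_of_pos (by linarith), ← neg_sub r s, inv_neg]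
    field_simp

/-- The limit of the side annotation of two edges that converge to segments of the imaginary axis.
Only the points of the first edge that converge to interior points of the second one matter, and
these have to stay on one side of the second edge. -/
theorem tendsto_integral_viewAngle {ι : Type*} {l : Filter ι} [l.IsCountablyGenerated]
    {P Q R S : ι → ℂ} {p q r s σ : ℝ}
    (hP : Tendsto P l (𝓝 (p * Complex.I))) (hQ : Tendsto Q l (𝓝 (q * Complex.I)))
    (hR : Tendsto R l (𝓝 (r * Complex.I))) (hS : Tendsto S l (𝓝 (s * Complex.I)))
    (hrs : r ≠ s) (hσ : σ = 1 ∨ σ = -1)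
    (hside : ∀ t ∈ Set.Ioo (0 : ℝ) 1, AffineMap.lineMap r s t ∈ Set.Ioo (min p q) (max p q) →
      ∀ᶠ n in l, 0 < σ * signedArea (P n) (Q n) (AffineMap.lineMap (R n) (S n) t)) :
    Tendsto (fun n => ∫ t in (0 : ℝ)..1, viewAngle (AffineMap.lineMap (R n) (S n) t) (P n) (Q n)) l
      (𝓝 (σ * (Real.pi *
        (max 0 (min (max r s) (max p q) - max (min r s) (min p q)) / |r - s|)))) := by
  rw [← mul_assoc, ← integral_indicator_lineMap p q _ hrs]
  refine intervalIntegral.tendsto_integral_filter_of_dominated_convergence (fun _ => Real.pi)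
    (Eventually.of_forall fun n => (measurable_viewAngle_lineMap _ _ _ _).aestronglyMeasurable)
    (Eventually.of_forall fun n => ae_of_all _ fun t _ => abs_viewAngle_le _ _ _)
    intervalIntegrable_const ?_
  -- The excluded values are an end of the first edge and the points that converge to the ends of
  -- the second edge, where the view angle need not converge.
  have hae : ∀ᵐ t : ℝ, t ∉ ({1, (p - r) / (s - r), (q - r) / (s - r)} : Set ℝ) :=
    compl_mem_ae_iff.2 (Set.Finite.measure_zero (by simp) _)
  filter_upwards [hae] with t ht h01
  rw [Set.uIoc_of_le zero_le_one] at h01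
  simp only [Set.mem_insert_iff, Set.mem_singleton_iff, not_or] at ht
  have hsr : s - r ≠ 0 := sub_ne_zero.2 hrs.symm
  have h01' : t ∈ Set.Ioo (0 : ℝ) 1 := ⟨h01.1, lt_of_le_of_ne h01.2 ht.1⟩
  set z := AffineMap.lineMap r s t with hz
  have hzp : z ≠ p := fun h => ht.2.1 (by rw [eq_div_iff hsr, ← h, hz, lineMap_real]; ring)
  have hzq : z ≠ q := fun h => ht.2.2 (by rw [eq_div_iff hsr, ← h, hz, lineMap_real]; ring)
  have hZ : Tendsto (fun n => (AffineMap.lineMap (R n) (S n) t : ℂ)) l (𝓝 (z * Complex.I)) := by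
    have : (z * Complex.I : ℂ) = AffineMap.lineMap (r * Complex.I) (s * Complex.I) t := by
      rw [hz, lineMap_real, AffineMap.lineMap_apply]
      simp; ring
    rw [this]
    simp only [AffineMap.lineMap_apply, vsub_eq_sub, vadd_eq_add]
    exact ((hS.sub hR).const_smul t).add hR
  by_cases hmem : z ∈ Set.Ioc (min p q) (max p q)
  · rw [Set.indicator_of_mem hmem]
    have hmem' : z ∈ Set.Ioo (min p q) (max p q) := by
      refine ⟨hmem.1, lt_of_le_of_ne hmem.2 fun h => ?_⟩
      rcases max_choice p q with h' | h' <;> rw [h'] at h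
      · exact hzp h
      · exact hzq h
    exact tendsto_viewAngle_of_mem hP hQ hZ hmem' hσ (hside t h01' hmem')
  · rw [Set.indicator_of_notMem hmem]
    refine tendsto_viewAngle_of_notMem hP hQ hZ ?_
    by_contra! hcon
    refine hmem ⟨lt_of_le_of_ne hcon.1 fun h => ?_, hcon.2⟩
    rcases min_choice p q with h' | h' <;> rw [h'] at h
    · exact hzp h.symm
    · exact hzq h.symm

/-! ### Sides of edges in nontouching drawings -/

/-- The interior points of the segment from `r` to `s` that are at the height of some point of the
segment from `p` to `q` are strictly to the left (for `σ = 1`) or strictly to the right (for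
`σ = -1`) of the line from `p` to `q`. -/
def OnSide (σ : ℝ) (p q r s : ℂ) : Prop :=
  ∀ t ∈ Set.Ioo (0 : ℝ) 1, AffineMap.lineMap r.im s.im t ∈ Set.uIcc p.im q.im →
    0 < σ * signedArea p q (AffineMap.lineMap r s t)

theorem lineMap_neg_neg {E : Type*} [AddCommGroup E] [Module ℝ E] (r s : E) (t : ℝ) :
    AffineMap.lineMap (-r) (-s) t = -AffineMap.lineMap r s t := by
  simp [AffineMap.lineMap_apply, smul_sub]
  abel

theorem OnSide.neg {σ : ℝ} {p q r s : ℂ} (h : OnSide σ p q r s) :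
    OnSide σ (-p) (-q) (-r) (-s) := by
  intro t ht hmem
  rw [lineMap_neg_neg, signedArea_neg]
  refine h t ht ?_
  rw [Complex.neg_im, Complex.neg_im, Complex.neg_im, Complex.neg_im, lineMap_neg_neg] at hmem
  rw [Set.mem_uIcc] at hmem ⊢
  rcases hmem with h | h
  · exact Or.inr ⟨by linarith, by linarith⟩
  · exact Or.inl ⟨by linarith, by linarith⟩

/-- A segment has a point `w` at each of its heights, and the horizontal distance to `w` decides on
which side of the segment a point at the same height lies. -/
theorem exists_mem_segment_im_eq {p q z : ℂ} (hz : z.im ∈ Set.uIcc p.im q.im) :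
    ∃ w ∈ segment ℝ p q, w.im = z.im ∧ signedArea p q z = (q.im - p.im) * (w.re - z.re) := by
  rw [← segment_eq_uIcc, segment_eq_image_lineMap] at hz
  obtain ⟨t, ht, htz⟩ := hz
  refine ⟨AffineMap.lineMap p q t, ?_, by rw [lineMap_im, htz], ?_⟩
  · rw [segment_eq_image_lineMap]
    exact ⟨t, ht, rfl⟩
  · rw [signedArea, lineMap_re, ← htz, lineMap_real, lineMap_real]
    ring

theorem IsNontouching.lineMap_notMem_segment {V : Type*} {G : SimpleGraph V} {x : V → ℂ}
    (hx : IsNontouching G x) {e f : G.Dart} (hef : e.edge ≠ f.edge) {t : ℝ}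
    (ht : t ∈ Set.Ioo (0 : ℝ) 1) :
    AffineMap.lineMap (x e.fst) (x e.snd) t ∉ segment ℝ (x f.fst) (x f.snd) := by
  intro hmem
  obtain ⟨v, hve, -, hv⟩ := hx.2 e f hef _ ⟨by
    rw [segment_eq_image_lineMap]; exact ⟨t, ⟨ht.1.le, ht.2.le⟩, rfl⟩, hmem⟩
  have hne : x e.fst ≠ x e.snd := fun h => e.adj.ne (hx.1 h)
  rcases Sym2.mem_iff.1 hve with rfl | rfl
  · have := AffineMap.lineMap_injective ℝ hne
      (hv.symm.trans (AffineMap.lineMap_apply_zero _ _).symm)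
    exact ht.1.ne' this
  · have := AffineMap.lineMap_injective ℝ hne (hv.symm.trans (AffineMap.lineMap_apply_one _ _).symm)
    exact ht.2.ne this

theorem IsNontouching.signedArea_ne_zero {V : Type*} {G : SimpleGraph V} {x : V → ℂ}
    (hx : IsNontouching G x) {e f : G.Dart} (hef : e.edge ≠ f.edge)
    (hf : (x f.fst).im ≠ (x f.snd).im) {t : ℝ} (ht : t ∈ Set.Ioo (0 : ℝ) 1)
    (hmem : AffineMap.lineMap (x e.fst).im (x e.snd).im t ∈ Set.uIcc (x f.fst).im (x f.snd).im) :
    signedArea (x f.fst) (x f.snd) (AffineMap.lineMap (x e.fst) (x e.snd) t) ≠ 0 := by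
  intro h0
  rw [← lineMap_im] at hmem
  obtain ⟨w, hw, hwz, harea⟩ := exists_mem_segment_im_eq hmem
  rw [h0, eq_comm, mul_eq_zero, sub_eq_zero, sub_eq_zero] at harea
  refine hx.lineMap_notMem_segment hef ht ?_
  rwa [← Complex.ext (harea.resolve_left hf.symm) hwz]

/-- In a nontouching drawing, an edge stays on one side of every other edge that is not horizontal,
as far as both extend over the same heights. -/
theorem IsNontouching.onSide_or {V : Type*} {G : SimpleGraph V} {x : V → ℂ}
    (hx : IsNontouching G x) {e f : G.Dart} (hef : e.edge ≠ f.edge)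
    (hf : (x f.fst).im ≠ (x f.snd).im) :
    OnSide 1 (x f.fst) (x f.snd) (x e.fst) (x e.snd) ∨
      OnSide (-1) (x f.fst) (x f.snd) (x e.fst) (x e.snd) := by
  set T : Set ℝ := Set.Ioo 0 1 ∩
    (AffineMap.lineMap (x e.fst).im (x e.snd).im : ℝ →ᵃ[ℝ] ℝ) ⁻¹' Set.uIcc (x f.fst).im (x f.snd).im
  have hT : IsPreconnected T := by
    refine Convex.isPreconnected ((convex_Ioo 0 1).inter ?_)
    exact (convex_uIcc _ _).affine_preimage _
  have hcont : ContinuousOn (fun t : ℝ => signedArea (x f.fst) (x f.snd)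
      (AffineMap.lineMap (x e.fst) (x e.snd) t)) T := by
    refine Continuous.continuousOn ?_
    simp only [signedArea, lineMap_re, lineMap_im, lineMap_real]
    fun_prop
  by_contra! hcon
  simp only [OnSide, not_forall, not_lt, one_mul, neg_one_mul, neg_nonpos] at hcon
  obtain ⟨⟨t, ht, htm, h1⟩, t', ht', htm', h2⟩ := hcon
  obtain ⟨t0, ht0, h0⟩ := hT.intermediate_value (⟨ht, htm⟩ : t ∈ T) (⟨ht', htm'⟩ : t' ∈ T) hcont
    (⟨h1, h2⟩ : (0 : ℝ) ∈ Set.Icc _ _)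
  exact hx.signedArea_ne_zero hef hf ht0.1 ht0.2 h0

/-! ### Edges trapped in a narrow wedge -/

/-- The cone of upward directions that deviate from the vertical by at most the slope `1 / 2`. -/
def upCone : Set ℂ := {z | |z.re| ≤ z.im / 2}

theorem isClosed_upCone : IsClosed upCone :=
  isClosed_le Complex.continuous_re.abs (Complex.continuous_im.div_const 2)

theorem add_mem_upCone {u v : ℂ} (hu : u ∈ upCone) (hv : v ∈ upCone) : u + v ∈ upCone := by
  have h1 : |u.re| ≤ u.im / 2 := hu
  have h2 : |v.re| ≤ v.im / 2 := hv
  change |(u + v).re| ≤ (u + v).im / 2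
  rw [Complex.add_re, Complex.add_im]
  linarith [abs_add_le u.re v.re]

/-- An edge from `r` up to `s` that is to the right of one arm and to the left of the other arm of a
narrow upward wedge has its lower end `r` inside the wedge. -/
theorem sub_mem_upCone_of_trapped {p q₁ q₂ r s : ℂ} (h₁ : q₁ - p ∈ upCone) (h₂ : q₂ - p ∈ upCone)
    (hrq₁ : r.im < q₁.im) (hrq₂ : r.im < q₂.im) (hpq₁ : p.im < q₁.im) (hpq₂ : p.im < q₂.im)
    (hps : p.im < s.im) (hrs : r.im < s.im) (hside₁ : OnSide (-1) p q₁ r s)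
    (hside₂ : OnSide 1 p q₂ r s) : r - p ∈ upCone := by
  rcases lt_or_ge r.im p.im with hrp | hpr
  · -- Otherwise the edge would cross the height of `p` both to the right and to the left of `p`.
    exfalso
    have hsr : 0 < s.im - r.im := by linarith
    set t := (p.im - r.im) / (s.im - r.im) with ht
    have ht01 : t ∈ Set.Ioo (0 : ℝ) 1 :=
      ⟨div_pos (by linarith) hsr, (div_lt_one hsr).2 (by linarith)⟩
    have him : AffineMap.lineMap r.im s.im t = p.im := by
      rw [lineMap_real, ht]; field_simp; ring
    have k₁ := hside₁ t ht01 (by rw [him]; exact Set.left_mem_uIcc)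
    have k₂ := hside₂ t ht01 (by rw [him]; exact Set.left_mem_uIcc)
    simp only [signedArea, lineMap_im, him, sub_self, mul_zero, zero_sub] at k₁ k₂
    rw [neg_mul_neg, one_mul, mul_pos_iff_of_pos_left (sub_pos.2 hpq₁)] at k₁
    rw [one_mul, ← mul_neg, mul_pos_iff_of_pos_left (sub_pos.2 hpq₂)] at k₂
    linarith
  · have key : ∀ σ : ℝ, ∀ q : ℂ, r.im < q.im → p.im < q.im → OnSide σ p q r s →
        0 ≤ σ * signedArea p q r := by
      intro σ q hrq hpq hside
      have hcont : Continuous fun t : ℝ => σ * signedArea p q (AffineMap.lineMap r s t) := by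
        simp only [signedArea, lineMap_re, lineMap_im, lineMap_real]
        fun_prop
      have hlim : Tendsto (fun t : ℝ => σ * signedArea p q (AffineMap.lineMap r s t)) (𝓝[>] 0)
          (𝓝 (σ * signedArea p q r)) := by
        have := (hcont.tendsto 0).mono_left (nhdsWithin_le_nhds (s := Set.Ioi 0))
        rwa [AffineMap.lineMap_apply_zero] at this
      have hheight : ∀ᶠ t : ℝ in 𝓝[>] 0, AffineMap.lineMap r.im s.im t < q.im := by
        have hc : Continuous fun t : ℝ => AffineMap.lineMap r.im s.im t :=
          AffineMap.lineMap_continuous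
        refine nhdsWithin_le_nhds ((hc.tendsto 0).eventually_lt_const ?_)
        rwa [AffineMap.lineMap_apply_zero]
      refine ge_of_tendsto hlim ?_
      filter_upwards [hheight, Ioo_mem_nhdsGT (zero_lt_one' ℝ)] with t h1 h2
      refine (hside t h2 ?_).le
      rw [Set.uIcc_of_le hpq.le]
      refine ⟨?_, h1.le⟩
      rw [lineMap_real]
      nlinarith [h2.1]
    have k₁ := key _ _ hrq₁ hpq₁ hside₁
    have k₂ := key _ _ hrq₂ hpq₂ hside₂
    have c₁ : |(q₁ - p).re| ≤ (q₁ - p).im / 2 := h₁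
    have c₂ : |(q₂ - p).re| ≤ (q₂ - p).im / 2 := h₂
    change |(r - p).re| ≤ (r - p).im / 2
    simp only [signedArea, Complex.sub_re, Complex.sub_im] at *
    rw [abs_le] at *
    constructor
    · have : 0 ≤ (q₁.im - p.im) * ((r.re - p.re) + (r.im - p.im) / 2) := by nlinarith
      linarith [nonneg_of_mul_nonneg_right this (by linarith)]
    · have : 0 ≤ (q₂.im - p.im) * ((r.im - p.im) / 2 - (r.re - p.re)) := by nlinarith
      linarith [nonneg_of_mul_nonneg_right this (by linarith)]

/-- The same as `sub_mem_upCone_of_trapped`, for a downward wedge. -/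
theorem sub_mem_upCone_of_trapped_down {p q₁ q₂ r s : ℂ} (h₁ : p - q₁ ∈ upCone)
    (h₂ : p - q₂ ∈ upCone) (hrq₁ : q₁.im < r.im) (hrq₂ : q₂.im < r.im) (hpq₁ : q₁.im < p.im)
    (hpq₂ : q₂.im < p.im) (hps : s.im < p.im) (hrs : s.im < r.im)
    (hside₁ : OnSide (-1) p q₁ r s) (hside₂ : OnSide 1 p q₂ r s) : p - r ∈ upCone := by
  have := sub_mem_upCone_of_trapped (p := -p) (q₁ := -q₁) (q₂ := -q₂) (r := -r) (s := -s)
    (by rwa [neg_sub_neg]) (by rwa [neg_sub_neg]) (by simpa) (by simpa) (by simpa) (by simpa)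
    (by simpa) (by simpa) hside₁.neg hside₂.neg
  rwa [neg_sub_neg] at this

/-- Moving the lower end of a steep segment by a short steep upward vector shortens the segment. -/
theorem eq_zero_of_norm_sub_eq {u v : ℂ} (hu : u ∈ upCone) (hv : v ∈ upCone)
    (huv : u.im < v.im) (h : ‖v - u‖ = ‖v‖) : u = 0 := by
  have hu' : |u.re| ≤ u.im / 2 := hu
  have hv' : |v.re| ≤ v.im / 2 := hv
  have hsq : (v.re - u.re) ^ 2 + (v.im - u.im) ^ 2 = v.re ^ 2 + v.im ^ 2 := by
    have := congrArg (· ^ 2) h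
    simpa only [Complex.sq_norm, Complex.normSq_apply, Complex.sub_re, Complex.sub_im, ← sq]
      using this
  have h0 : 0 ≤ u.im := by linarith [abs_nonneg u.re]
  have hprod : |u.re * v.re| ≤ u.im / 2 * (v.im / 2) := by
    rw [abs_mul]
    exact mul_le_mul hu' hv' (abs_nonneg _) (by linarith)
  have hre : u.re ^ 2 ≤ (u.im / 2) ^ 2 := sq_le_sq' (by linarith [neg_abs_le u.re])
    (by linarith [le_abs_self u.re])
  have him : u.im = 0 := by
    by_contra hne
    have hpos : 0 < u.im := lt_of_le_of_ne h0 (Ne.symm hne)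
    nlinarith [neg_abs_le (u.re * v.re), mul_pos hpos (sub_pos.2 huv)]
  have hre0 : u.re = 0 := by
    rw [him] at hu'
    exact abs_nonpos_iff.1 (by linarith)
  exact Complex.ext hre0 him

/-! ### Rigid motions -/

theorem lineMap_rigid (u w p q : ℂ) (t : ℝ) :
    AffineMap.lineMap (u * p + w) (u * q + w) t = u * AffineMap.lineMap p q t + w := by
  simp only [AffineMap.lineMap_apply, vsub_eq_sub, vadd_eq_add, Complex.real_smul]
  ring

theorem sideAnnotation_rigid {V : Type*} (G : SimpleGraph V) {u : ℂ} (hu : u ≠ 0) (w : ℂ)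
    (x : V → ℂ) : sideAnnotation G (fun v => u * x v + w) = sideAnnotation G x := by
  funext e f
  simp only [sideAnnotation, lineMap_rigid, viewAngle, add_sub_add_right_eq_sub, ← mul_sub,
    mul_div_mul_left _ _ hu]

theorem IsNontouching.rigid {V : Type*} {G : SimpleGraph V} {u : ℂ} (hu : u ≠ 0) (w : ℂ)
    {x : V → ℂ} (hx : IsNontouching G x) : IsNontouching G (fun v => u * x v + w) := by
  refine ⟨fun i j h => hx.1 (mul_left_cancel₀ hu (add_right_cancel h)), ?_⟩
  rintro e f hef z ⟨hze, hzf⟩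
  rw [segment_eq_image_lineMap] at hze hzf
  obtain ⟨t, ht, rfl⟩ := hze
  obtain ⟨t', ht', h⟩ := hzf
  rw [lineMap_rigid, lineMap_rigid] at h
  have h' := mul_left_cancel₀ hu (add_right_cancel h)
  obtain ⟨v, hve, hvf, hv⟩ := hx.2 e f hef _ ⟨by
    rw [segment_eq_image_lineMap]; exact ⟨t, ht, rfl⟩, by
    rw [segment_eq_image_lineMap]; exact ⟨t', ht', h'⟩⟩
  exact ⟨v, hve, hvf, by rw [lineMap_rigid, ← hv]⟩

theorem Linkage.rigid_mem_selfTouchingSpace {V : Type*} (L : Linkage V) {u : ℂ} (hu : ‖u‖ = 1)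
    (w : ℂ) {c : AnnotatedDrawing L.graph} (hc : c ∈ L.selfTouchingSpace) :
    ((fun v => u * c.1 v + w, c.2) : AnnotatedDrawing L.graph) ∈ L.selfTouchingSpace := by
  have hu0 : u ≠ 0 := by rintro rfl; simp at hu
  refine ⟨fun i j hij => ?_, ?_⟩
  · have := hc.1 i j hij
    rw [dist_eq_norm] at this ⊢
    rw [add_sub_add_right_eq_sub, ← mul_sub, norm_mul, hu, one_mul, this]
  · have hcont : Continuous fun c : AnnotatedDrawing L.graph =>
        ((fun v => u * c.1 v + w, c.2) : AnnotatedDrawing L.graph) := by fun_prop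
    refine map_mem_closure (f := fun c : AnnotatedDrawing L.graph =>
      ((fun v => u * c.1 v + w, c.2) : AnnotatedDrawing L.graph)) hcont hc.2 ?_
    rintro _ ⟨x, hx, rfl⟩
    exact ⟨_, IsNontouching.rigid hu0 w hx, by rw [annotate, sideAnnotation_rigid _ hu0]; rfl⟩

/-! ### Positions forced by the wedges -/

/-- The hooks `A C F E` and `B D G` are interlocked in the wedge at `B`.  If each of `E`, `F`, `G`,
`D` stays inside the wedge in which it is placed, then all of them are at their original positions
relative to the edge `A B`. -/
theorem hook_positions {a b : ℝ} (hb : 0 < b) {A B C D E F G : ℂ}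
    (hAB : dist A B = a) (hAC : dist A C = a + b) (hBD : dist B D = b) (hEF : dist E F = b)
    (hDG : dist D G = b) (hCF : dist C F = b)
    (hBDc : B - D ∈ upCone) (hBCc : B - C ∈ upCone)
    (hED : E - D ∈ upCone) (hBF : B - F ∈ upCone) (hFG : F - G ∈ upCone) (hDC : D - C ∈ upCone)
    (h₁ : (E - D + (B - F)).im < (B - D).im) (h₂ : (B - G).im < (B - D).im)
    (h₃ : (D - C).im < (B - C).im) :
    D = C ∧ E = C ∧ F = B ∧ G = B ∧ ‖B - C‖ = b ∧ A - C = ((a + b) / b : ℝ) * (B - C) := by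
  rw [dist_eq_norm] at hBD hEF hDG hCF
  -- `F - E` and `B - D` have equal lengths, so `E` and `F` sit in the apices of their wedges.
  have hsum : E - D + (B - F) = 0 := by
    refine eq_zero_of_norm_sub_eq (add_mem_upCone hED hBF) hBDc h₁ ?_
    rw [hBD, ← hEF, ← norm_neg]
    congr 1
    ring
  have hED' : |(E - D).re| ≤ (E - D).im / 2 := hED
  have hBF' : |(B - F).re| ≤ (B - F).im / 2 := hBF
  have him := congrArg Complex.im hsum
  rw [Complex.add_im, Complex.zero_im] at him
  have hE : E = D := by
    refine sub_eq_zero.1 (Complex.ext ?_ ?_)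
    · refine abs_nonpos_iff.1 ?_
      linarith [abs_nonneg (B - F).re]
    · rw [Complex.zero_im]
      linarith [abs_nonneg (E - D).re, abs_nonneg (B - F).re]
  have hF : F = B := by
    rw [hE, sub_self, zero_add] at hsum
    exact (sub_eq_zero.1 hsum).symm
  subst hE hF
  have hG : F = G := by
    refine sub_eq_zero.1 (eq_zero_of_norm_sub_eq hFG hBDc h₂ ?_)
    rw [hBD, ← hDG, ← norm_neg]
    congr 1
    ring
  subst hG
  have hD : E = C := by
    refine sub_eq_zero.1 (eq_zero_of_norm_sub_eq hDC hBCc h₃ ?_)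
    rw [sub_sub_sub_cancel_right, hBD, ← hCF, norm_sub_rev]
  subst hD
  refine ⟨rfl, rfl, rfl, rfl, hBD, ?_⟩
  -- The path `A B C` is as long as the edge `A C`, so it is straight.
  have hw : Wbtw ℝ A F E := by
    rw [← dist_add_dist_eq_iff, hAB, hAC, dist_eq_norm, hBD]
  obtain ⟨t, ht, rfl⟩ := hw
  rw [dist_left_lineMap, hAC, Real.norm_of_nonneg ht.1] at hAB
  have h1t : (1 - t) * (a + b) = b := by linarith
  have hk : (a + b) / b * (1 - t) = 1 := by field_simp; linarith
  have hvec : (AffineMap.lineMap A E t : ℂ) - E = ((1 - t : ℝ) : ℂ) * (A - E) := by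
    rw [AffineMap.lineMap_apply]
    simp only [vsub_eq_sub, vadd_eq_add, Complex.real_smul, Complex.ofReal_sub, Complex.ofReal_one]
    ring
  rw [hvec, ← mul_assoc, ← Complex.ofReal_mul, hk, Complex.ofReal_one, one_mul]

/-! ### The tree -/

instance : Fintype TreeVertex where
  elems := {A, B, C, D, E, F, G, H, I, J, K, L}
  complete v := by cases v <;> decide

instance : Finite treeGraph.Dart :=
  Finite.of_injective SimpleGraph.Dart.toProd SimpleGraph.Dart.toProd_injective

theorem treeGraph_adj {u v : TreeVertex} : treeGraph.Adj u v ↔ s(u, v) ∈ treeEdges ∧ u ≠ v := by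
  simp [treeGraph]

theorem edge_mem_treeEdges (e : treeGraph.Dart) : e.edge ∈ treeEdges :=
  (treeGraph_adj.1 e.adj).1

theorem abs_treeHeight_sub {a b : ℝ} (ha : 0 < a) (hb : 0 < b) {u v : TreeVertex}
    (h : treeGraph.Adj u v) :
    |treeHeight a b u - treeHeight a b v| = treeLength a b s(u, v) := by
  rw [treeGraph_adj] at h
  revert h
  cases u <;> cases v <;>
    simp [treeEdges, treeHeight, treeLength, abs_of_pos, ha, hb, add_pos] <;>
    rw [← neg_add, abs_neg, abs_of_pos] <;> linarith

theorem treeLength_pos {a b : ℝ} (ha : 0 < a) (hb : 0 < b) (e : Sym2 TreeVertex) :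
    0 < treeLength a b e := by
  unfold treeLength
  split_ifs <;> linarith

theorem treeHeight_ne {a b : ℝ} (ha : 0 < a) (hb : 0 < b) {u v : TreeVertex}
    (h : treeGraph.Adj u v) : treeHeight a b u ≠ treeHeight a b v := by
  intro heq
  have := abs_treeHeight_sub ha hb h
  rw [heq, sub_self, abs_zero] at this
  exact (treeLength_pos ha hb _).ne this

theorem selfTouchingTree_realizes {a b : ℝ} (ha : 0 < a) (hb : 0 < b) :
    (treeLinkage a b ha hb).Realizes (selfTouchingTree a b).1 := by
  intro u v huv
  change dist ((treeHeight a b u : ℂ) * Complex.I) (treeHeight a b v * Complex.I) = _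
  rw [dist_eq_norm, ← sub_mul, norm_mul, Complex.norm_I, mul_one, ← Complex.ofReal_sub,
    Complex.norm_real, Real.norm_eq_abs]
  exact abs_treeHeight_sub ha hb huv

/-- The side of `f` on which `e` lies in the self-touching tree: `1` for the left side of the
oriented edge `f`, and `-1` for its right side. -/
noncomputable def treeSide (a b : ℝ) (e f : treeGraph.Dart) : ℝ :=
  (if treeEdges.idxOf e.edge < treeEdges.idxOf f.edge then 1 else -1) *
    (if treeHeight a b f.fst < treeHeight a b f.snd then 1 else -1)

theorem treeSide_eq (a b : ℝ) (e f : treeGraph.Dart) :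
    treeSide a b e f = 1 ∨ treeSide a b e f = -1 := by
  unfold treeSide
  split_ifs <;> simp

theorem treeAnnotation_eq (a b : ℝ) {e f : treeGraph.Dart} (hef : e.edge ≠ f.edge) :
    treeAnnotation a b e f =
      treeSide a b e f * (Real.pi * (treeOverlap a b e f / treeLength a b e.edge)) := by
  rw [treeAnnotation, if_neg hef, treeSide]

theorem sideAnnotation_of_ne {V : Type*} (G : SimpleGraph V) (x : V → ℂ) {e f : G.Dart}
    (hef : e.edge ≠ f.edge) : sideAnnotation G x e f = ∫ t in (0 : ℝ)..1,
      viewAngle (AffineMap.lineMap (x e.fst) (x e.snd) t) (x f.fst) (x f.snd) := by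
  rw [sideAnnotation, if_neg hef]

/-- Drawings that converge to the vertical placement have annotations that converge to the ones
determined by the sides of overlapping edges. -/
theorem tendsto_sideAnnotation {a b : ℝ} (ha : 0 < a) (hb : 0 < b) {ι : Type*} {l : Filter ι}
    [l.IsCountablyGenerated] {x : ι → TreeVertex → ℂ}
    (hx : Tendsto x l (𝓝 (selfTouchingTree a b).1)) {e f : treeGraph.Dart} (hef : e.edge ≠ f.edge)
    {σ : ℝ} (hσ : σ = 1 ∨ σ = -1)
    (hside : 0 < treeOverlap a b e f →
      ∀ᶠ n in l, OnSide σ (x n f.fst) (x n f.snd) (x n e.fst) (x n e.snd)) :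
    Tendsto (fun n => sideAnnotation treeGraph (x n) e f) l
      (𝓝 (σ * (Real.pi * (treeOverlap a b e f / treeLength a b e.edge)))) := by
  have hv : ∀ v, Tendsto (fun n => x n v) l (𝓝 (treeHeight a b v * Complex.I)) :=
    tendsto_pi_nhds.1 hx
  have him : ∀ v, Tendsto (fun n => (x n v).im) l (𝓝 (treeHeight a b v)) := fun v => by
    simpa [Function.comp_def] using (Complex.continuous_im.tendsto _).comp (hv v)
  have hlen : treeLength a b e.edge = |treeHeight a b e.fst - treeHeight a b e.snd| :=
    (abs_treeHeight_sub ha hb e.adj).symm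
  have hne := treeHeight_ne ha hb e.adj
  simp only [sideAnnotation_of_ne _ _ hef, hlen]
  refine tendsto_integral_viewAngle (hv _) (hv _) (hv _) (hv _) hne hσ ?_
  intro t ht hmem
  have hmem' : AffineMap.lineMap (treeHeight a b e.fst) (treeHeight a b e.snd) t ∈
      Set.Ioo (min (treeHeight a b e.fst) (treeHeight a b e.snd))
        (max (treeHeight a b e.fst) (treeHeight a b e.snd)) := by
    rw [lineMap_real]
    rcases hne.lt_or_gt with h | h
    · rw [min_eq_left h.le, max_eq_right h.le]
      constructor <;> nlinarith [ht.1, ht.2]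
    · rw [min_eq_right h.le, max_eq_left h.le]
      constructor <;> nlinarith [ht.1, ht.2]
  have hover : 0 < treeOverlap a b e f :=
    lt_max_of_lt_right (sub_pos.2 ((max_lt hmem'.1 hmem.1).trans (lt_min hmem'.2 hmem.2)))
  have hz : Tendsto (fun n => AffineMap.lineMap (x n e.fst).im (x n e.snd).im t) l
      (𝓝 (AffineMap.lineMap (treeHeight a b e.fst) (treeHeight a b e.snd) t)) := by
    simp only [lineMap_real]
    exact (((him _).sub (him _)).mul_const t).add (him _)
  filter_upwards [hside hover, ((him f.fst).min (him f.snd)).eventually_lt hz hmem.1,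
    hz.eventually_lt ((him f.fst).max (him f.snd)) hmem.2] with n h1 h2 h3
  exact h1 t ht ⟨h2.le, h3.le⟩

theorem eventually_im_ne {a b : ℝ} (ha : 0 < a) (hb : 0 < b) (f : treeGraph.Dart) :
    ∀ᶠ x in 𝓝 (selfTouchingTree a b).1, (x f.fst).im ≠ (x f.snd).im := by
  have him : ∀ v, Tendsto (fun x : TreeVertex → ℂ => (x v).im) (𝓝 (selfTouchingTree a b).1)
      (𝓝 (treeHeight a b v)) := fun v => by
    have h : Continuous fun x : TreeVertex → ℂ => (x v).im := by fun_prop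
    simpa [selfTouchingTree] using h.tendsto (selfTouchingTree a b).1
  have := ((him f.fst).sub (him f.snd)).eventually_ne (sub_ne_zero.2 (treeHeight_ne ha hb f.adj))
  exact this.mono fun x hx => sub_ne_zero.1 hx

/-- The annotated nontouching drawings of the tree. -/
def nontouchingDrawings : Set (AnnotatedDrawing treeGraph) :=
  annotate treeGraph '' {x | IsNontouching treeGraph x}

/-- In a nontouching drawing whose positions and annotations are close to those of the self-touching
tree, overlapping edges lie on the sides prescribed by the annotations: on the wrong side, the
annotation would be close to the negative of its prescribed value. -/
theorem eventually_onSide {a b : ℝ} (ha : 0 < a) (hb : 0 < b) :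
    ∀ᶠ c in 𝓝 (selfTouchingTree a b), c ∈ nontouchingDrawings → ∀ e f : treeGraph.Dart,
      e.edge ≠ f.edge → 0 < treeOverlap a b e f →
        OnSide (treeSide a b e f) (c.1 f.fst) (c.1 f.snd) (c.1 e.fst) (c.1 e.snd) := by
  suffices h : ∀ e f : treeGraph.Dart, e.edge ≠ f.edge → 0 < treeOverlap a b e f →
      ∀ᶠ c in 𝓝 (selfTouchingTree a b), c ∈ nontouchingDrawings →
        OnSide (treeSide a b e f) (c.1 f.fst) (c.1 f.snd) (c.1 e.fst) (c.1 e.snd) by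
    have h' : ∀ᶠ c in 𝓝 (selfTouchingTree a b), ∀ e f : treeGraph.Dart, e.edge ≠ f.edge →
        0 < treeOverlap a b e f → c ∈ nontouchingDrawings →
        OnSide (treeSide a b e f) (c.1 f.fst) (c.1 f.snd) (c.1 e.fst) (c.1 e.snd) := by
      simp only [eventually_all]
      exact h
    exact h'.mono fun c hc hmem e f hef ho => hc e f hef ho hmem
  intro e f hef ho
  by_contra hcon
  set W : Set (AnnotatedDrawing treeGraph) := {c | c ∈ nontouchingDrawings ∧
    ¬ OnSide (treeSide a b e f) (c.1 f.fst) (c.1 f.snd) (c.1 e.fst) (c.1 e.snd)}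
  have hfreq : ∃ᶠ c in 𝓝 (selfTouchingTree a b), c ∈ W :=
    (not_eventually.1 hcon).mono fun c hc => Classical.not_imp.1 hc
  have : (𝓝 (selfTouchingTree a b) ⊓ 𝓟 W).NeBot := frequently_mem_iff_neBot.1 hfreq
  have hid : Tendsto id (𝓝 (selfTouchingTree a b) ⊓ 𝓟 W) (𝓝 (selfTouchingTree a b)) := inf_le_left
  have hW : ∀ᶠ c in 𝓝 (selfTouchingTree a b) ⊓ 𝓟 W, c ∈ W :=
    eventually_inf_principal.2 (Eventually.of_forall fun _ h => h)
  have hpos : Tendsto Prod.fst (𝓝 (selfTouchingTree a b) ⊓ 𝓟 W) (𝓝 (selfTouchingTree a b).1) :=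
    (continuous_fst.tendsto _).comp hid
  have hann : Tendsto (fun c : AnnotatedDrawing treeGraph => c.2 e f)
      (𝓝 (selfTouchingTree a b) ⊓ 𝓟 W) (𝓝 (treeAnnotation a b e f)) := by
    have hc : Continuous fun c : AnnotatedDrawing treeGraph => c.2 e f := by fun_prop
    exact (hc.tendsto (selfTouchingTree a b)).comp hid
  have hlim := tendsto_sideAnnotation ha hb hpos hef (σ := -treeSide a b e f)
    (by rcases treeSide_eq a b e f with h | h <;> simp [h]) fun _ => by
      filter_upwards [hW, hpos.eventually (eventually_im_ne ha hb f)] with c hc him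
      obtain ⟨⟨x, hx, rfl⟩, hnot⟩ := hc
      have hor := IsNontouching.onSide_or hx hef him
      change ¬ OnSide _ (x f.fst) (x f.snd) (x e.fst) (x e.snd) at hnot
      change OnSide _ (x f.fst) (x f.snd) (x e.fst) (x e.snd)
      rcases treeSide_eq a b e f with h | h <;> rw [h] at hnot ⊢
      · exact hor.resolve_left hnot
      · rw [neg_neg]
        exact hor.resolve_right hnot
  have heq : (fun c : AnnotatedDrawing treeGraph => sideAnnotation treeGraph c.1 e f) =ᶠ[
      𝓝 (selfTouchingTree a b) ⊓ 𝓟 W] fun c => c.2 e f := by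
    filter_upwards [hW] with c hc
    obtain ⟨⟨x, hx, rfl⟩, -⟩ := hc
    rfl
  have := tendsto_nhds_unique (hlim.congr' heq) hann
  rw [treeAnnotation_eq a b hef] at this
  have hfrac : 0 < Real.pi * (treeOverlap a b e f / treeLength a b e.edge) :=
    mul_pos Real.pi_pos (div_pos ho (treeLength_pos ha hb _))
  rcases treeSide_eq a b e f with h | h <;> rw [h] at this <;> linarith

/-! ### Rigidity -/

theorem sub_mem_upCone_of_near {b p q : ℝ} {x y : ℂ} (hb : 0 < b)
    (hx : |x.re| < b / 16 ∧ |x.im - p| < b / 16) (hy : |y.re| < b / 16 ∧ |y.im - q| < b / 16)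
    (hpq : p + b ≤ q) : y - x ∈ upCone := by
  simp only [abs_lt] at hx hy
  change |(y - x).re| ≤ (y - x).im / 2
  rw [Complex.sub_re, Complex.sub_im, abs_le]
  constructor <;> linarith [hx.1.1, hx.1.2, hx.2.1, hx.2.2, hy.1.1, hy.1.2, hy.2.1, hy.2.2]

/-- Two long edges overlap if both start at the bottom, or if both descend from the center. -/
theorem treeOverlap_pos {a b : ℝ} (hb : 0 < b) {p q r s : TreeVertex} (hrs : treeGraph.Adj r s)
    (hpq : treeGraph.Adj p q) (h : (b ≤ treeHeight a b s ∧ b ≤ treeHeight a b q ∧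
      treeHeight a b r = 0 ∧ treeHeight a b p = 0) ∨ (treeHeight a b s = 0 ∧ treeHeight a b q = 0 ∧
      treeHeight a b r = b ∧ treeHeight a b p = b)) :
    0 < treeOverlap a b ⟨(r, s), hrs⟩ ⟨(p, q), hpq⟩ := by
  refine lt_max_of_lt_right (sub_pos.2 ?_)
  change max (min (treeHeight a b r) (treeHeight a b s)) (min (treeHeight a b p) (treeHeight a b q))
    < min (max (treeHeight a b r) (treeHeight a b s)) (max (treeHeight a b p) (treeHeight a b q))
  rcases h with ⟨h1, h2, h3, h4⟩ | ⟨h1, h2, h3, h4⟩ <;> rw [h3, h4]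
  · have hs : 0 < treeHeight a b s := by linarith
    have hq : 0 < treeHeight a b q := by linarith
    simp [hs, hq, hs.le, hq.le]
  · rw [h1, h2]
    simp [hb, hb.le]

/-- If the upward edge `r s` comes between the upward edges `p q₁` and `p q₂` in the left-to-right
order, then its lower end is trapped between them. -/
theorem trapped_up {a b : ℝ} (hb : 0 < b) {x : TreeVertex → ℂ}
    (hnear : ∀ v, |(x v).re| < b / 16 ∧ |(x v).im - treeHeight a b v| < b / 16)
    (hside : ∀ e f : treeGraph.Dart, e.edge ≠ f.edge → 0 < treeOverlap a b e f →
      OnSide (treeSide a b e f) (x f.fst) (x f.snd) (x e.fst) (x e.snd))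
    {p q₁ q₂ r s : TreeVertex} (hrs : treeGraph.Adj r s) (hq₁ : treeGraph.Adj p q₁)
    (hq₂ : treeGraph.Adj p q₂) (h₁ : treeEdges.idxOf s(p, q₁) < treeEdges.idxOf s(r, s))
    (h₂ : treeEdges.idxOf s(r, s) < treeEdges.idxOf s(p, q₂)) (hp : treeHeight a b p = 0)
    (hr : treeHeight a b r = 0) (hs : b ≤ treeHeight a b s) (k₁ : b ≤ treeHeight a b q₁)
    (k₂ : b ≤ treeHeight a b q₂) : x r - x p ∈ upCone := by
  have hs₁ := hside ⟨(r, s), hrs⟩ ⟨(p, q₁), hq₁⟩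
    (fun h => h₁.ne (congrArg (fun e => treeEdges.idxOf e) h).symm)
    (treeOverlap_pos hb _ _ (Or.inl ⟨hs, k₁, hr, hp⟩))
  have hs₂ := hside ⟨(r, s), hrs⟩ ⟨(p, q₂), hq₂⟩
    (fun h => h₂.ne (congrArg (fun e => treeEdges.idxOf e) h))
    (treeOverlap_pos hb _ _ (Or.inl ⟨hs, k₂, hr, hp⟩))
  have e₁ : treeSide a b ⟨(r, s), hrs⟩ ⟨(p, q₁), hq₁⟩ = -1 := by
    change (if treeEdges.idxOf s(r, s) < treeEdges.idxOf s(p, q₁) then (1 : ℝ) else -1) *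
      (if treeHeight a b p < treeHeight a b q₁ then 1 else -1) = -1
    rw [if_neg h₁.asymm, if_pos (by linarith), mul_one]
  have e₂ : treeSide a b ⟨(r, s), hrs⟩ ⟨(p, q₂), hq₂⟩ = 1 := by
    change (if treeEdges.idxOf s(r, s) < treeEdges.idxOf s(p, q₂) then (1 : ℝ) else -1) *
      (if treeHeight a b p < treeHeight a b q₂ then 1 else -1) = 1
    rw [if_pos h₂, if_pos (by linarith), mul_one]
  rw [e₁] at hs₁
  rw [e₂] at hs₂
  have np := abs_lt.1 (hnear p).2
  have nr := abs_lt.1 (hnear r).2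
  have ns := abs_lt.1 (hnear s).2
  have nq₁ := abs_lt.1 (hnear q₁).2
  have nq₂ := abs_lt.1 (hnear q₂).2
  exact sub_mem_upCone_of_trapped (sub_mem_upCone_of_near hb (hnear p) (hnear q₁) (by linarith))
    (sub_mem_upCone_of_near hb (hnear p) (hnear q₂) (by linarith))
    (by linarith) (by linarith) (by linarith) (by linarith) (by linarith) (by linarith) hs₁ hs₂

/-- If the downward edge `r s` comes between the downward edges `p q₂` and `p q₁` in the
left-to-right order, then its upper end is trapped between them. -/
theorem trapped_down {a b : ℝ} (hb : 0 < b) {x : TreeVertex → ℂ}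
    (hnear : ∀ v, |(x v).re| < b / 16 ∧ |(x v).im - treeHeight a b v| < b / 16)
    (hside : ∀ e f : treeGraph.Dart, e.edge ≠ f.edge → 0 < treeOverlap a b e f →
      OnSide (treeSide a b e f) (x f.fst) (x f.snd) (x e.fst) (x e.snd))
    {p q₁ q₂ r s : TreeVertex} (hrs : treeGraph.Adj r s) (hq₁ : treeGraph.Adj p q₁)
    (hq₂ : treeGraph.Adj p q₂) (h₁ : treeEdges.idxOf s(r, s) < treeEdges.idxOf s(p, q₁))
    (h₂ : treeEdges.idxOf s(p, q₂) < treeEdges.idxOf s(r, s)) (hp : treeHeight a b p = b)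
    (hr : treeHeight a b r = b) (hs : treeHeight a b s = 0) (k₁ : treeHeight a b q₁ = 0)
    (k₂ : treeHeight a b q₂ = 0) : x p - x r ∈ upCone := by
  have hs₁ := hside ⟨(r, s), hrs⟩ ⟨(p, q₁), hq₁⟩
    (fun h => h₁.ne (congrArg (fun e => treeEdges.idxOf e) h))
    (treeOverlap_pos hb _ _ (Or.inr ⟨hs, k₁, hr, hp⟩))
  have hs₂ := hside ⟨(r, s), hrs⟩ ⟨(p, q₂), hq₂⟩
    (fun h => h₂.ne (congrArg (fun e => treeEdges.idxOf e) h).symm)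
    (treeOverlap_pos hb _ _ (Or.inr ⟨hs, k₂, hr, hp⟩))
  have e₁ : treeSide a b ⟨(r, s), hrs⟩ ⟨(p, q₁), hq₁⟩ = -1 := by
    change (if treeEdges.idxOf s(r, s) < treeEdges.idxOf s(p, q₁) then (1 : ℝ) else -1) *
      (if treeHeight a b p < treeHeight a b q₁ then 1 else -1) = -1
    rw [if_pos h₁, if_neg (by linarith), one_mul]
  have e₂ : treeSide a b ⟨(r, s), hrs⟩ ⟨(p, q₂), hq₂⟩ = 1 := by
    change (if treeEdges.idxOf s(r, s) < treeEdges.idxOf s(p, q₂) then (1 : ℝ) else -1) *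
      (if treeHeight a b p < treeHeight a b q₂ then 1 else -1) = 1
    rw [if_neg h₂.asymm, if_neg (by linarith), neg_one_mul, neg_neg]
  rw [e₁] at hs₁
  rw [e₂] at hs₂
  have np := abs_lt.1 (hnear p).2
  have nr := abs_lt.1 (hnear r).2
  have ns := abs_lt.1 (hnear s).2
  have nq₁ := abs_lt.1 (hnear q₁).2
  have nq₂ := abs_lt.1 (hnear q₂).2
  exact sub_mem_upCone_of_trapped_down
    (sub_mem_upCone_of_near hb (hnear q₁) (hnear p) (by linarith))
    (sub_mem_upCone_of_near hb (hnear q₂) (hnear p) (by linarith))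
    (by linarith) (by linarith) (by linarith) (by linarith) (by linarith) (by linarith) hs₁ hs₂

/-- The positions in which each of the eight trapped edges has its end inside the wedge in which it
is placed. -/
def trappedPositions : Set (TreeVertex → ℂ) :=
  {x | (x E - x D ∈ upCone ∧ x B - x F ∈ upCone ∧ x F - x G ∈ upCone ∧ x D - x C ∈ upCone) ∧
    (x J - x H ∈ upCone ∧ x B - x K ∈ upCone ∧ x K - x L ∈ upCone ∧ x H - x I ∈ upCone)}

theorem isClosed_trappedPositions : IsClosed trappedPositions := by
  have h : ∀ u v : TreeVertex, IsClosed {x : TreeVertex → ℂ | x u - x v ∈ upCone} := fun u v =>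
    isClosed_upCone.preimage (by fun_prop : Continuous fun x : TreeVertex → ℂ => x u - x v)
  exact ((h _ _).inter ((h _ _).inter ((h _ _).inter (h _ _)))).inter
    ((h _ _).inter ((h _ _).inter ((h _ _).inter (h _ _))))

theorem mem_trappedPositions {a b : ℝ} (ha : 0 < a) (hb : 0 < b) {x : TreeVertex → ℂ}
    (hnear : ∀ v, |(x v).re| < b / 16 ∧ |(x v).im - treeHeight a b v| < b / 16)
    (hside : ∀ e f : treeGraph.Dart, e.edge ≠ f.edge → 0 < treeOverlap a b e f →
      OnSide (treeSide a b e f) (x f.fst) (x f.snd) (x e.fst) (x e.snd)) :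
    x ∈ trappedPositions := by
  have adj : ∀ {u v : TreeVertex}, s(u, v) ∈ treeEdges → u ≠ v → treeGraph.Adj u v :=
    fun h h' => treeGraph_adj.2 ⟨h, h'⟩
  have hba : b ≤ a + b := by linarith
  refine ⟨⟨?_, ?_, ?_, ?_⟩, ?_, ?_, ?_, ?_⟩
  · exact trapped_up hb hnear hside (p := D) (q₁ := B) (q₂ := G) (r := E) (s := F)
      (adj (by decide) (by decide)) (adj (by decide) (by decide)) (adj (by decide) (by decide))
      (by decide) (by decide) rfl rfl le_rfl le_rfl le_rfl
  · exact trapped_down hb hnear hside (p := B) (q₁ := H) (q₂ := D) (r := F) (s := E)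
      (adj (by decide) (by decide)) (adj (by decide) (by decide)) (adj (by decide) (by decide))
      (by decide) (by decide) rfl rfl rfl rfl rfl
  · exact trapped_down hb hnear hside (p := F) (q₁ := C) (q₂ := E) (r := G) (s := D)
      (adj (by decide) (by decide)) (adj (by decide) (by decide)) (adj (by decide) (by decide))
      (by decide) (by decide) rfl rfl rfl rfl rfl
  · exact trapped_up hb hnear hside (p := C) (q₁ := A) (q₂ := F) (r := D) (s := B)
      (adj (by decide) (by decide)) (adj (by decide) (by decide)) (adj (by decide) (by decide))
      (by decide) (by decide) rfl rfl le_rfl hba le_rfl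
  · exact trapped_up hb hnear hside (p := H) (q₁ := L) (q₂ := B) (r := J) (s := K)
      (adj (by decide) (by decide)) (adj (by decide) (by decide)) (adj (by decide) (by decide))
      (by decide) (by decide) rfl rfl le_rfl le_rfl le_rfl
  · exact trapped_down hb hnear hside (p := B) (q₁ := H) (q₂ := D) (r := K) (s := J)
      (adj (by decide) (by decide)) (adj (by decide) (by decide)) (adj (by decide) (by decide))
      (by decide) (by decide) rfl rfl rfl rfl rfl
  · exact trapped_down hb hnear hside (p := K) (q₁ := J) (q₂ := I) (r := L) (s := H)
      (adj (by decide) (by decide)) (adj (by decide) (by decide)) (adj (by decide) (by decide))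
      (by decide) (by decide) rfl rfl rfl rfl rfl
  · exact trapped_up hb hnear hside (p := I) (q₁ := K) (q₂ := A) (r := H) (s := B)
      (adj (by decide) (by decide)) (adj (by decide) (by decide)) (adj (by decide) (by decide))
      (by decide) (by decide) rfl rfl le_rfl le_rfl hba

/-- Trapped positions with the edge lengths of the tree form a rigid image of the vertical
placement.  Since `C` is placed at `0` and `B` at `b * I`, the rigid motion must have the linear part
`(x B - x C) / (b * I)` and the translation part `x C`. -/
theorem positions_of_trapped {a b : ℝ} (ha : 0 < a) (hb : 0 < b) {x : TreeVertex → ℂ}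
    (hnear : ∀ v, |(x v).re| < b / 16 ∧ |(x v).im - treeHeight a b v| < b / 16)
    (hx : (treeLinkage a b ha hb).Realizes x) (htrap : x ∈ trappedPositions) :
    ∃ u w : ℂ, ‖u‖ = 1 ∧ ∀ v, x v = u * (selfTouchingTree a b).1 v + w := by
  have hd : ∀ {u v : TreeVertex}, s(u, v) ∈ treeEdges → u ≠ v →
      dist (x u) (x v) = treeLength a b s(u, v) := fun h h' => hx _ _ (treeGraph_adj.2 ⟨h, h'⟩)
  have hAB : dist (x A) (x B) = a := by rw [hd (by decide) (by decide)]; rfl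
  have hup : ∀ {u v : TreeVertex}, treeHeight a b u = 0 → treeHeight a b v = b →
      x v - x u ∈ upCone := fun {u v} hu hv => by
    refine sub_mem_upCone_of_near hb (hnear u) (hnear v) ?_
    rw [hu, hv, zero_add]
  have him : ∀ v, treeHeight a b v - b / 16 < (x v).im ∧ (x v).im < treeHeight a b v + b / 16 := by
    intro v
    have := abs_lt.1 (hnear v).2
    constructor <;> linarith
  have hB := him B
  have hC := him C
  have hD := him D
  have hE := him E
  have hF := him F
  have hG := him G
  have hH := him H
  have hI := him I
  have hJ := him J
  have hK := him K
  have hL := him L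
  simp only [treeHeight] at hB hC hD hE hF hG hH hI hJ hK hL
  obtain ⟨⟨t1, t2, t3, t4⟩, t5, t6, t7, t8⟩ := htrap
  have len : ∀ {u v : TreeVertex}, s(u, v) ∈ treeEdges → u ≠ v → s(u, v) ≠ s(A, B) →
      ¬ (s(u, v) = s(A, C) ∨ s(u, v) = s(A, I)) → dist (x u) (x v) = b := fun h h' h1 h2 => by
    rw [hd h h', treeLength, if_neg h1, if_neg h2]
  have len' : ∀ {u v : TreeVertex}, s(u, v) ∈ treeEdges → u ≠ v → s(u, v) ≠ s(A, B) →
      (s(u, v) = s(A, C) ∨ s(u, v) = s(A, I)) → dist (x u) (x v) = a + b := fun h h' h1 h2 => by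
    rw [hd h h', treeLength, if_neg h1, if_pos h2]
  obtain ⟨eD, eE, eF, eG, hnorm, eA⟩ := hook_positions hb hAB
    (len' (u := A) (v := C) (by decide) (by decide) (by decide) (by decide))
    (len (u := B) (v := D) (by decide) (by decide) (by decide) (by decide))
    (len (u := E) (v := F) (by decide) (by decide) (by decide) (by decide))
    (len (u := D) (v := G) (by decide) (by decide) (by decide) (by decide))
    (len (u := C) (v := F) (by decide) (by decide) (by decide) (by decide))
    (hup rfl rfl) (hup rfl rfl) t1 t2 t3 t4
    (by simp only [Complex.add_im, Complex.sub_im]; linarith)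
    (by simp only [Complex.sub_im]; linarith) (by simp only [Complex.sub_im]; linarith)
  obtain ⟨eH, eJ, eK, eL, -, eA'⟩ := hook_positions hb hAB
    (len' (u := A) (v := I) (by decide) (by decide) (by decide) (by decide))
    (len (u := B) (v := H) (by decide) (by decide) (by decide) (by decide))
    (len (u := J) (v := K) (by decide) (by decide) (by decide) (by decide))
    (len (u := H) (v := L) (by decide) (by decide) (by decide) (by decide))
    (len (u := I) (v := K) (by decide) (by decide) (by decide) (by decide))
    (hup rfl rfl) (hup rfl rfl) t5 t6 t7 t8
    (by simp only [Complex.add_im, Complex.sub_im]; linarith)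
    (by simp only [Complex.sub_im]; linarith) (by simp only [Complex.sub_im]; linarith)
  have hb0 : (b : ℂ) ≠ 0 := by exact_mod_cast hb.ne'
  have eI : x I = x C := by
    have h : ((a / b : ℝ) : ℂ) * (x I - x C) = 0 := by
      have h1 : (((a + b) / b : ℝ) : ℂ) = ((a / b : ℝ) : ℂ) + 1 := by
        push_cast; field_simp
      rw [h1] at eA eA'
      linear_combination eA' - eA
    refine sub_eq_zero.1 ((mul_eq_zero.1 h).resolve_left ?_)
    exact_mod_cast (div_pos ha hb).ne'
  rw [eI] at eH eJ
  refine ⟨(x B - x C) / (b * Complex.I), x C, ?_, ?_⟩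
  · rw [norm_div, hnorm, norm_mul, Complex.norm_I, mul_one, Complex.norm_real,
      Real.norm_of_nonneg hb.le, div_self hb.ne']
  · have hgen : ∀ h : ℝ, (x B - x C) / (b * Complex.I) * (h * Complex.I) = (h / b : ℝ) * (x B - x C)
        := by
      intro h
      have := Complex.I_ne_zero
      push_cast
      field_simp
    have bot : ∀ v, treeHeight a b v = 0 → x v = x C →
        x v = (x B - x C) / (b * Complex.I) * (selfTouchingTree a b).1 v + x C := by
      intro v h0 hv
      change _ = _ * (treeHeight a b v * Complex.I) + _
      rw [hv, h0, hgen]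
      simp
    have mid : ∀ v, treeHeight a b v = b → x v = x B →
        x v = (x B - x C) / (b * Complex.I) * (selfTouchingTree a b).1 v + x C := by
      intro v h0 hv
      change _ = _ * (treeHeight a b v * Complex.I) + _
      rw [hv, h0, hgen, div_self hb.ne']
      simp
    intro v
    cases v
    case A =>
      change x A = (x B - x C) / (b * Complex.I) * ((a + b : ℝ) * Complex.I) + x C
      rw [hgen, ← eA]
      ring
    case B => exact mid _ rfl rfl
    case C => exact bot _ rfl rfl
    case D => exact bot _ rfl eD
    case E => exact bot _ rfl eE
    case F => exact mid _ rfl eF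
    case G => exact mid _ rfl eG
    case H => exact bot _ rfl eH
    case I => exact bot _ rfl eI
    case J => exact bot _ rfl eJ
    case K => exact mid _ rfl eK
    case L => exact mid _ rfl eL

/-- With every vertex at a distance of less than `b / 16` in both coordinates, the edges of length
`b` or more deviate from the vertical by a slope of less than `1 / 2`. -/
theorem isOpen_near (a b : ℝ) : IsOpen {c : AnnotatedDrawing treeGraph |
    ∀ v, |(c.1 v).re| < b / 16 ∧ |(c.1 v).im - treeHeight a b v| < b / 16} := by
  simp only [Set.ofPred_forall]
  refine isOpen_iInter_of_finite fun v => ?_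
  have h₁ : Continuous fun c : AnnotatedDrawing treeGraph => |(c.1 v).re| := by fun_prop
  have h₂ : Continuous fun c : AnnotatedDrawing treeGraph => |(c.1 v).im - treeHeight a b v| := by
    fun_prop
  exact (isOpen_lt h₁ continuous_const).inter (isOpen_lt h₂ continuous_const)

/-- Configurations close to the self-touching tree have the positions of a rigid image of it. -/
theorem eventually_positions {a b : ℝ} (ha : 0 < a) (hb : 0 < b) :
    ∀ᶠ c in 𝓝 (selfTouchingTree a b), c ∈ (treeLinkage a b ha hb).selfTouchingSpace →
      ∃ u w : ℂ, ‖u‖ = 1 ∧ ∀ v, c.1 v = u * (selfTouchingTree a b).1 v + w := by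
  have hnear := (isOpen_near a b).mem_nhds (x := selfTouchingTree a b) fun v => by
    simp [selfTouchingTree, hb]
  obtain ⟨U, hU, hUo, hcU⟩ := eventually_nhds_iff.1 ((eventually_onSide ha hb).and hnear)
  refine eventually_nhds_iff.2 ⟨U, fun c hc hcL => ?_, hUo, hcU⟩
  refine positions_of_trapped ha hb (hU c hc).2 hcL.1 ?_
  have hcl : c ∈ closure (U ∩ nontouchingDrawings) := hUo.inter_closure ⟨hc, hcL.2⟩
  refine closure_minimal (t := Prod.fst ⁻¹' trappedPositions) ?_
    (isClosed_trappedPositions.preimage continuous_fst) hcl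
  rintro c' ⟨hc'U, hc'⟩
  exact mem_trappedPositions ha hb (hU c' hc'U).2 ((hU c' hc'U).1 hc')

/-- A configuration at the positions of the self-touching tree, whose annotations are close to those
of the tree, has the annotations of the tree, because nearby annotations determine the sides of
overlapping edges, and the sides determine the annotations. -/
theorem eventually_annotation_eq {a b : ℝ} (ha : 0 < a) (hb : 0 < b) :
    ∀ᶠ c in 𝓝 (selfTouchingTree a b), c ∈ closure nontouchingDrawings →
      c.1 = (selfTouchingTree a b).1 → c.2 = (selfTouchingTree a b).2 := by
  obtain ⟨U, hU, hUo, hcU⟩ := eventually_nhds_iff.1 (eventually_onSide ha hb)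
  refine eventually_nhds_iff.2 ⟨U, fun c hc hcl hpos => ?_, hUo, hcU⟩
  have hcl' : c ∈ closure (U ∩ nontouchingDrawings) := hUo.inter_closure ⟨hc, hcl⟩
  have : (𝓝[U ∩ nontouchingDrawings] c).NeBot := mem_closure_iff_nhdsWithin_neBot.1 hcl'
  have hcg : (𝓝[U ∩ nontouchingDrawings] c).IsCountablyGenerated := by
    unfold nhdsWithin; infer_instance
  have hid : Tendsto id (𝓝[U ∩ nontouchingDrawings] c) (𝓝 c) := nhdsWithin_le_nhds
  have hfst : Tendsto Prod.fst (𝓝[U ∩ nontouchingDrawings] c) (𝓝 (selfTouchingTree a b).1) :=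
    hpos ▸ (continuous_fst.tendsto _).comp hid
  funext e f
  have hann : Tendsto (fun c' : AnnotatedDrawing treeGraph => c'.2 e f)
      (𝓝[U ∩ nontouchingDrawings] c) (𝓝 (c.2 e f)) := by
    have hc : Continuous fun c : AnnotatedDrawing treeGraph => c.2 e f := by fun_prop
    exact (hc.tendsto c).comp hid
  have heq : (fun c : AnnotatedDrawing treeGraph => sideAnnotation treeGraph c.1 e f) =ᶠ[
      𝓝[U ∩ nontouchingDrawings] c] fun c => c.2 e f := by
    filter_upwards [self_mem_nhdsWithin] with c' hc'
    obtain ⟨-, x, hx, rfl⟩ := hc'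
    rfl
  have hlim : Tendsto (fun c : AnnotatedDrawing treeGraph => sideAnnotation treeGraph c.1 e f)
      (𝓝[U ∩ nontouchingDrawings] c) (𝓝 (treeAnnotation a b e f)) := by
    by_cases hef : e.edge = f.edge
    · simp [sideAnnotation, treeAnnotation, hef]
    · rw [treeAnnotation_eq a b hef]
      refine tendsto_sideAnnotation ha hb hfst hef (treeSide_eq a b e f) fun ho => ?_
      filter_upwards [self_mem_nhdsWithin] with c' hc'
      exact hU c' hc'.1 hc'.2 e f hef ho
  exact tendsto_nhds_unique hann (hlim.congr' heq)

theorem Linkage.IsRigidImage.symm {V : Type*} {G : SimpleGraph V} {c c' : AnnotatedDrawing G}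
    (h : Linkage.IsRigidImage c c') : Linkage.IsRigidImage c' c := by
  obtain ⟨u, w, hu, hv, h2⟩ := h
  have hu0 : u ≠ 0 := by rintro rfl; simp at hu
  refine ⟨u⁻¹, -(u⁻¹ * w), by rw [norm_inv, hu, inv_one], fun v => ?_, h2.symm⟩
  rw [hv]
  field_simp
  ring

theorem Linkage.IsRigidImage.trans {V : Type*} {G : SimpleGraph V} {c c' c'' : AnnotatedDrawing G}
    (h : Linkage.IsRigidImage c c') (h' : Linkage.IsRigidImage c' c'') :
    Linkage.IsRigidImage c c'' := by
  obtain ⟨u, w, hu, hv, h2⟩ := h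
  obtain ⟨u', w', hu', hv', h2'⟩ := h'
  refine ⟨u' * u, u' * w + w', by rw [norm_mul, hu, hu', one_mul], fun v => ?_, h2'.trans h2⟩
  rw [hv', hv]
  ring

theorem isClosed_isRigidImage {a b : ℝ} (hb : 0 < b) :
    IsClosed {c | Linkage.IsRigidImage (selfTouchingTree a b) c} := by
  have hb0 : (b : ℂ) * Complex.I ≠ 0 :=
    mul_ne_zero (by exact_mod_cast hb.ne') Complex.I_ne_zero
  -- The rigid motion is determined by the images of `B` and `C`, and depends continuously on them.
  have heq : {c | Linkage.IsRigidImage (selfTouchingTree a b) c} =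
      {c : AnnotatedDrawing treeGraph | ‖(c.1 B - c.1 C) / (b * Complex.I)‖ = 1 ∧
        (∀ v, c.1 v = (c.1 B - c.1 C) / (b * Complex.I) * (selfTouchingTree a b).1 v + c.1 C) ∧
        c.2 = (selfTouchingTree a b).2} := by
    ext c
    constructor
    · rintro ⟨u, w, hu, hv, h2⟩
      have hB : c.1 B = u * (b * Complex.I) + w := hv B
      have hC : c.1 C = w := by
        rw [hv C]
        simp [selfTouchingTree, treeHeight]
      have hBC : (c.1 B - c.1 C) / (b * Complex.I) = u := by
        rw [hB, hC, add_sub_cancel_right, mul_div_cancel_right₀ _ hb0]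
      exact ⟨by rw [hBC, hu], fun v => by rw [hBC, hC, hv], h2⟩
    · rintro ⟨hu, hv, h2⟩
      exact ⟨_, _, hu, hv, h2⟩
  rw [heq]
  have hu : Continuous fun c : AnnotatedDrawing treeGraph =>
      (c.1 B - c.1 C) / (b * Complex.I) := by fun_prop
  have hpos : IsClosed {c : AnnotatedDrawing treeGraph | ∀ v,
      c.1 v = (c.1 B - c.1 C) / (b * Complex.I) * (selfTouchingTree a b).1 v + c.1 C} := by
    simp only [Set.ofPred_forall]
    refine isClosed_iInter fun v => isClosed_eq (by fun_prop) ?_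
    exact (hu.mul continuous_const).add (by fun_prop)
  exact (isClosed_eq hu.norm continuous_const).inter
    (hpos.inter (isClosed_eq continuous_snd continuous_const))

/-- All configurations close to the self-touching tree are rigid images of it. -/
theorem eventually_isRigidImage {a b : ℝ} (ha : 0 < a) (hb : 0 < b) :
    ∀ᶠ c in 𝓝 (selfTouchingTree a b), c ∈ (treeLinkage a b ha hb).selfTouchingSpace →
      Linkage.IsRigidImage (selfTouchingTree a b) c := by
  have hann : ∀ᶠ s in 𝓝 (selfTouchingTree a b).2,
      ((selfTouchingTree a b).1, s) ∈ closure nontouchingDrawings →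
        s = (selfTouchingTree a b).2 := by
    have hc : Continuous fun s : treeGraph.Dart → treeGraph.Dart → ℝ =>
        (((selfTouchingTree a b).1, s) : AnnotatedDrawing treeGraph) := by fun_prop
    exact ((hc.tendsto (selfTouchingTree a b).2).eventually
      (eventually_annotation_eq ha hb)).mono fun s hs hmem => hs hmem rfl
  filter_upwards [eventually_positions ha hb,
    (continuous_snd.tendsto (selfTouchingTree a b)).eventually hann] with c h1 h2 hc
  obtain ⟨u, w, hu, hv⟩ := h1 hc
  -- After undoing the rigid motion, only the annotations remain to be compared.
  obtain ⟨u', w', hu', hv', -⟩ := Linkage.IsRigidImage.symm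
    (⟨u, w, hu, hv, rfl⟩ : Linkage.IsRigidImage ((selfTouchingTree a b).1, c.2) c)
  have hmem := ((treeLinkage a b ha hb).rigid_mem_selfTouchingSpace hu' w' hc).2
  rw [← funext hv'] at hmem
  exact ⟨u, w, hu, hv, h2 hmem⟩

/-- The set of times at which a motion is at a rigid image of the tree is closed, open, and contains
`0`. -/
theorem selfTouchingTree_isRigid {a b : ℝ} (ha : 0 < a) (hb : 0 < b) :
    (treeLinkage a b ha hb).IsRigid (selfTouchingTree a b) := by
  rintro γ ⟨hγ, hγ0, hmem⟩
  set T : Set unitInterval := {t | Linkage.IsRigidImage (selfTouchingTree a b) (γ t)}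
  have hclosed : IsClosed T := (isClosed_isRigidImage hb).preimage hγ
  have hopen : IsOpen T := by
    refine isOpen_iff_mem_nhds.2 fun t ht => ?_
    obtain ⟨u, w, hu, hv, h2⟩ := Linkage.IsRigidImage.symm ht
    -- The rigid motion that carries `γ t` back to the self-touching tree brings the nearby
    -- configurations of the motion close to the tree.
    have hcont : Continuous fun t' => ((fun v => u * (γ t').1 v + w, (γ t').2) :
        AnnotatedDrawing treeGraph) := by fun_prop
    have hlim := hcont.tendsto t
    rw [← funext hv, ← h2] at hlim
    filter_upwards [hlim.eventually (eventually_isRigidImage ha hb)] with t' ht'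
    refine (ht' ((treeLinkage a b ha hb).rigid_mem_selfTouchingSpace hu w (hmem t'))).trans ?_
    exact Linkage.IsRigidImage.symm ⟨u, w, hu, fun _ => rfl, rfl⟩
  have hT : T = Set.univ := IsClopen.eq_univ ⟨hclosed, hopen⟩
    ⟨0, 1, 0, norm_one, fun v => by rw [hγ0, one_mul, add_zero], by rw [hγ0]⟩
  exact fun t => (hT ▸ Set.mem_univ t : t ∈ T)

/-! ### Separated edges -/

/-- For vertices at the points `(x v, y v)`, a line that is not horizontal separates the edge `e` on
its left from the edge `f` on its right.  For at least one of the two edges, no vertex lies on the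
line except those that belong to both edges. -/
def Separated {V : Type*} (x y : V → ℝ) (e f : Sym2 V) : Prop :=
  ∃ k m n : ℝ, 0 < k ∧ (∀ v ∈ e, k * x v ≤ m * y v + n) ∧ (∀ v ∈ f, m * y v + n ≤ k * x v) ∧
    ((∀ v ∈ e, v ∉ f → k * x v < m * y v + n) ∨ (∀ v ∈ f, v ∉ e → m * y v + n < k * x v))

section Separated

variable {V : Type*} {x y : V → ℝ}

/-- The line of the edge `u v` itself separates it from every edge on its right. -/
theorem Separated.of_left_line {u v : V} {f : Sym2 V} (huv : y u < y v)
    (h : ∀ w ∈ f, w ∉ s(u, v) →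
      (x v - x u) * (y w - y u) - (y v - y u) * (x w - x u) < 0) :
    Separated x y s(u, v) f := by
  refine ⟨y v - y u, x v - x u, (y v - y u) * x u - (x v - x u) * y u, by linarith, ?_, ?_,
    Or.inr fun w hw hw' => by linarith [h w hw hw']⟩
  · intro w hw
    rcases Sym2.mem_iff.1 hw with rfl | rfl
    · linarith
    · linarith
  · intro w hw
    by_cases hw' : w ∈ s(u, v)
    · rcases Sym2.mem_iff.1 hw' with rfl | rfl <;> linarith
    · linarith [h w hw hw']

/-- The line of the edge `u v` itself separates it from every edge on its left. -/
theorem Separated.of_right_line {u v : V} {e : Sym2 V} (huv : y u < y v)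
    (h : ∀ w ∈ e, w ∉ s(u, v) →
      0 < (x v - x u) * (y w - y u) - (y v - y u) * (x w - x u)) :
    Separated x y e s(u, v) := by
  refine ⟨y v - y u, x v - x u, (y v - y u) * x u - (x v - x u) * y u, by linarith, ?_, ?_,
    Or.inl fun w hw hw' => by linarith [h w hw hw']⟩
  · intro w hw
    by_cases hw' : w ∈ s(u, v)
    · rcases Sym2.mem_iff.1 hw' with rfl | rfl <;> linarith
    · linarith [h w hw hw']
  · intro w hw
    rcases Sym2.mem_iff.1 hw with rfl | rfl
    · linarith
    · linarith

theorem Separated.scale {e f : Sym2 V} (h : Separated x y e f) {c : ℝ} (hc : 0 < c) :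
    Separated (fun v => c * x v) y e f := by
  obtain ⟨k, m, n, hk, h1, h2, h3⟩ := h
  refine ⟨k, c * m, c * n, hk, fun v hv => ?_, fun v hv => ?_, ?_⟩
  · linarith [mul_le_mul_of_nonneg_left (h1 v hv) hc.le]
  · linarith [mul_le_mul_of_nonneg_left (h2 v hv) hc.le]
  · refine h3.imp (fun h v hv hv' => ?_) (fun h v hv hv' => ?_)
    · linarith [mul_lt_mul_of_pos_left (h v hv hv') hc]
    · linarith [mul_lt_mul_of_pos_left (h v hv hv') hc]

theorem Separated.mirror {e f : Sym2 V} (h : Separated x y e f) {τ : V → V}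
    (hx : ∀ v, x (τ v) = -x v) (hy : ∀ v, y (τ v) = y v) :
    Separated x y (f.map τ) (e.map τ) := by
  obtain ⟨k, m, n, hk, h1, h2, h3⟩ := h
  refine ⟨k, -m, -n, hk, ?_, ?_, ?_⟩
  · intro v hv
    obtain ⟨w, hw, rfl⟩ := Sym2.mem_map.1 hv
    rw [hx, hy]
    linarith [h2 w hw]
  · intro v hv
    obtain ⟨w, hw, rfl⟩ := Sym2.mem_map.1 hv
    rw [hx, hy]
    linarith [h1 w hw]
  · rcases h3 with h | h
    · refine Or.inr fun v hv hv' => ?_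
      obtain ⟨w, hw, rfl⟩ := Sym2.mem_map.1 hv
      rw [hx, hy]
      linarith [h w hw fun hwf => hv' (Sym2.mem_map.2 ⟨w, hwf, rfl⟩)]
    · refine Or.inl fun v hv hv' => ?_
      obtain ⟨w, hw, rfl⟩ := Sym2.mem_map.1 hv
      rw [hx, hy]
      linarith [h w hw fun hwf => hv' (Sym2.mem_map.2 ⟨w, hwf, rfl⟩)]

theorem nonneg_of_mem_segment {ℓ : ℂ → ℝ}
    (hℓ : ∀ (p q : ℂ) (t : ℝ),
      ℓ (AffineMap.lineMap p q t) = AffineMap.lineMap (ℓ p) (ℓ q) t) {p q z : ℂ}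
    (hp : 0 ≤ ℓ p) (hq : 0 ≤ ℓ q) (hz : z ∈ segment ℝ p q) : 0 ≤ ℓ z := by
  rw [segment_eq_image_lineMap] at hz
  obtain ⟨t, ht, rfl⟩ := hz
  rw [hℓ, lineMap_real]
  nlinarith [mul_nonneg ht.1 hq, mul_nonneg (sub_nonneg.2 ht.2) hp]

/-- If an edge lies in the half-plane `ℓ ≤ 0`, and only vertices that it shares with another edge
are on the boundary, then it meets the opposite half-plane only in such a shared vertex. -/
theorem exists_common_vertex_of_halfPlane {G : SimpleGraph V} {p : V → ℂ} {e f : G.Dart}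
    (hef : e.edge ≠ f.edge)
    {ℓ : ℂ → ℝ} (hℓ : ∀ (p q : ℂ) (t : ℝ),
      ℓ (AffineMap.lineMap p q t) = AffineMap.lineMap (ℓ p) (ℓ q) t)
    (h₁ : ∀ v ∈ e.edge, ℓ (p v) ≤ 0) (h₂ : ∀ v ∈ e.edge, v ∉ f.edge → ℓ (p v) < 0) {z : ℂ}
    (hz : z ∈ segment ℝ (p e.fst) (p e.snd)) (hℓz : 0 ≤ ℓ z) :
    ∃ v, v ∈ e.edge ∧ v ∈ f.edge ∧ p v = z := by
  have hfst : e.fst ∈ e.edge := Sym2.mem_mk_left _ _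
  have hsnd : e.snd ∈ e.edge := Sym2.mem_mk_right _ _
  rw [segment_eq_image_lineMap] at hz
  obtain ⟨t, ht, rfl⟩ := hz
  rw [hℓ, lineMap_real] at hℓz
  have k₁ := h₁ _ hfst
  have k₂ := h₁ _ hsnd
  by_cases c₁ : e.fst ∈ f.edge
  · by_cases c₂ : e.snd ∈ f.edge
    · exact absurd ((Sym2.mem_and_mem_iff e.adj.ne).1 ⟨c₁, c₂⟩).symm hef
    · refine ⟨e.fst, hfst, c₁, ?_⟩
      have k₃ := h₂ _ hsnd c₂
      have h0 : t = 0 := by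
        by_contra hne
        have hpos : 0 < t := lt_of_le_of_ne ht.1 (Ne.symm hne)
        nlinarith [mul_nonneg (sub_nonneg.2 ht.2) (neg_nonneg.2 k₁), mul_pos hpos (neg_pos.2 k₃)]
      rw [h0, AffineMap.lineMap_apply_zero]
  · have k₃ := h₂ _ hfst c₁
    have h1 : t = 1 := by
      by_contra hne
      have hpos : 0 < 1 - t := sub_pos.2 (lt_of_le_of_ne ht.2 hne)
      nlinarith [mul_nonneg ht.1 (neg_nonneg.2 k₂), mul_pos hpos (neg_pos.2 k₃)]
    subst h1
    by_cases c₂ : e.snd ∈ f.edge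
    · exact ⟨e.snd, hsnd, c₂, by rw [AffineMap.lineMap_apply_one]⟩
    · linarith [h₂ _ hsnd c₂]

theorem Separated.exists_common_vertex {G : SimpleGraph V} {e f : G.Dart}
    (h : Separated x y e.edge f.edge) (hef : e.edge ≠ f.edge) {p : V → ℂ}
    (hp : ∀ v, p v = ⟨x v, y v⟩) {z : ℂ} (hze : z ∈ segment ℝ (p e.fst) (p e.snd))
    (hzf : z ∈ segment ℝ (p f.fst) (p f.snd)) :
    ∃ v, v ∈ e.edge ∧ v ∈ f.edge ∧ p v = z := by
  obtain ⟨k, m, n, -, h1, h2, h3⟩ := h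
  have hℓ₁ : ∀ (p q : ℂ) (t : ℝ), k * (AffineMap.lineMap p q t : ℂ).re -
      (m * (AffineMap.lineMap p q t : ℂ).im + n) = AffineMap.lineMap (k * p.re - (m * p.im + n))
        (k * q.re - (m * q.im + n)) t := by
    intro p q t
    simp only [lineMap_re, lineMap_im, lineMap_real]
    ring
  have hℓ₂ : ∀ (p q : ℂ) (t : ℝ), (m * (AffineMap.lineMap p q t : ℂ).im + n) -
      k * (AffineMap.lineMap p q t : ℂ).re = AffineMap.lineMap ((m * p.im + n) - k * p.re)
        ((m * q.im + n) - k * q.re) t := by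
    intro p q t
    simp only [lineMap_re, lineMap_im, lineMap_real]
    ring
  have hre : ∀ v, (p v).re = x v := fun v => by rw [hp]
  have him : ∀ v, (p v).im = y v := fun v => by rw [hp]
  have m₁ : ∀ d : G.Dart, d.fst ∈ d.edge := fun d => Sym2.mem_mk_left _ _
  have m₂ : ∀ d : G.Dart, d.snd ∈ d.edge := fun d => Sym2.mem_mk_right _ _
  rcases h3 with h3 | h3
  · refine exists_common_vertex_of_halfPlane hef (ℓ := fun z => k * z.re - (m * z.im + n)) hℓ₁
      ?_ ?_ hze (nonneg_of_mem_segment (ℓ := fun z => k * z.re - (m * z.im + n)) hℓ₁ ?_ ?_ hzf) <;>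
      simp only [hre, him]
    · exact fun v hv => sub_nonpos.2 (h1 v hv)
    · exact fun v hv hv' => sub_neg.2 (h3 v hv hv')
    · exact sub_nonneg.2 (h2 _ (m₁ f))
    · exact sub_nonneg.2 (h2 _ (m₂ f))
  · obtain ⟨v, hv, hv', hvz⟩ := exists_common_vertex_of_halfPlane hef.symm
      (ℓ := fun z => (m * z.im + n) - k * z.re) hℓ₂
      (by simp only [hre, him]; exact fun v hv => sub_nonpos.2 (h2 v hv))
      (by simp only [hre, him]; exact fun v hv hv' => sub_neg.2 (h3 v hv hv')) hzf
      (nonneg_of_mem_segment (ℓ := fun z => (m * z.im + n) - k * z.re) hℓ₂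
        (by simp only [hre, him]; exact sub_nonneg.2 (h1 _ (m₁ e)))
        (by simp only [hre, him]; exact sub_nonneg.2 (h1 _ (m₂ e))) hze)
    exact ⟨v, hv', hv, hvz⟩

theorem Separated.mul_re_le {G : SimpleGraph V} {e f : G.Dart} (h : Separated x y e.edge f.edge)
    {p : V → ℂ} (hp : ∀ v, p v = ⟨x v, y v⟩) {z w : ℂ}
    (hz : z ∈ segment ℝ (p e.fst) (p e.snd)) (hw : w ∈ segment ℝ (p f.fst) (p f.snd))
    (hzw : w.im = z.im) : z.re ≤ w.re := by
  obtain ⟨k, m, n, hk, h1, h2, -⟩ := h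
  have hre : ∀ v, (p v).re = x v := fun v => by rw [hp]
  have him : ∀ v, (p v).im = y v := fun v => by rw [hp]
  have k₁ := nonneg_of_mem_segment (ℓ := fun z => (m * z.im + n) - k * z.re) (by
      intro p q t
      simp only [lineMap_re, lineMap_im, lineMap_real]
      ring)
    (by simp only [hre, him]; exact sub_nonneg.2 (h1 _ (Sym2.mem_mk_left _ _)))
    (by simp only [hre, him]; exact sub_nonneg.2 (h1 _ (Sym2.mem_mk_right _ _))) hz
  have k₂ := nonneg_of_mem_segment (ℓ := fun z => k * z.re - (m * z.im + n)) (by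
      intro p q t
      simp only [lineMap_re, lineMap_im, lineMap_real]
      ring)
    (by simp only [hre, him]; exact sub_nonneg.2 (h2 _ (Sym2.mem_mk_left _ _)))
    (by simp only [hre, him]; exact sub_nonneg.2 (h2 _ (Sym2.mem_mk_right _ _))) hw
  simp only [hzw] at k₁ k₂
  exact le_of_mul_le_mul_left (by linarith) hk

theorem lineMap_mem_segment (p q : ℂ) {t : ℝ} (ht : t ∈ Set.Ioo (0 : ℝ) 1) :
    AffineMap.lineMap p q t ∈ segment ℝ p q := by
  rw [segment_eq_image_lineMap]
  exact ⟨t, ⟨ht.1.le, ht.2.le⟩, rfl⟩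

/-- In a nontouching drawing, the left one of two separated edges is on the left side of the other
one if that one points upwards (`σ = 1`), and on its right side if it points downwards. -/
theorem Separated.onSide_left {G : SimpleGraph V} {e f : G.Dart} (h : Separated x y e.edge f.edge)
    {p : V → ℂ} (hp : ∀ v, p v = ⟨x v, y v⟩) (hn : IsNontouching G p) (hef : e.edge ≠ f.edge)
    {σ : ℝ} (hf : 0 < σ * ((p f.snd).im - (p f.fst).im)) :
    OnSide σ (p f.fst) (p f.snd) (p e.fst) (p e.snd) := by
  intro t ht hmem
  have hne : (p f.fst).im ≠ (p f.snd).im := fun h0 => by simp [h0] at hf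
  have h0 := hn.signedArea_ne_zero hef hne ht hmem
  rw [← lineMap_im] at hmem
  obtain ⟨w, hw, hwz, harea⟩ := exists_mem_segment_im_eq hmem
  rw [harea] at h0 ⊢
  rw [← mul_assoc]
  exact mul_pos hf (lt_of_le_of_ne
    (sub_nonneg.2 (h.mul_re_le hp (lineMap_mem_segment _ _ ht) hw hwz))
    (right_ne_zero_of_mul h0).symm)

theorem Separated.onSide_right {G : SimpleGraph V} {e f : G.Dart} (h : Separated x y f.edge e.edge)
    {p : V → ℂ} (hp : ∀ v, p v = ⟨x v, y v⟩) (hn : IsNontouching G p) (hef : e.edge ≠ f.edge)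
    {σ : ℝ} (hf : 0 < σ * ((p f.snd).im - (p f.fst).im)) :
    OnSide (-σ) (p f.fst) (p f.snd) (p e.fst) (p e.snd) := by
  intro t ht hmem
  have hne : (p f.fst).im ≠ (p f.snd).im := fun h0 => by simp [h0] at hf
  have h0 := hn.signedArea_ne_zero hef hne ht hmem
  rw [← lineMap_im] at hmem
  obtain ⟨w, hw, hwz, harea⟩ := exists_mem_segment_im_eq hmem
  rw [harea] at h0 ⊢
  rw [← mul_assoc, neg_mul, neg_mul, ← mul_neg, neg_sub]
  refine mul_pos hf (lt_of_le_of_ne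
    (sub_nonneg.2 (h.mul_re_le hp hw (lineMap_mem_segment _ _ ht) hwz.symm)) ?_)
  rw [ne_comm, sub_ne_zero, ne_comm]
  exact sub_ne_zero.1 (right_ne_zero_of_mul h0)

end Separated

/-! ### Nontouching drawings near the self-touching tree -/

/-- The reflection of the tree that exchanges its left and its right half. -/
def mirrorVertex : TreeVertex → TreeVertex
  | A => A | B => B | C => I | D => H | E => J | F => K | G => L
  | I => C | H => D | J => E | K => F | L => G

/-- The horizontal positions of the vertices in a nontouching drawing, before scaling.  The vertices
`C`, `D`, `E` are close to the lower end and `F`, `G` are close to the upper end of a line that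
descends from `B` to the left with slope `b`; the number `μ` measures the horizontal offset of the
vertices from this line. -/
def drawingX (μ θ : ℝ) : TreeVertex → ℝ
  | A | B => 0
  | C => -1
  | D => -1 + θ - μ
  | E => -1 + 2 * θ - μ * (1 - 2 * θ)
  | F => -θ + μ
  | G => -2 * θ + μ * (1 - 2 * θ)
  | I => 1
  | H => -(-1 + θ - μ)
  | J => -(-1 + 2 * θ - μ * (1 - 2 * θ))
  | K => -(-θ + μ)
  | L => -(-2 * θ + μ * (1 - 2 * θ))

/-- The heights of the vertices in a nontouching drawing: every vertex in the interior of a wedge is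
moved away from the apex of the wedge, by `b * θ` for each wedge around it. -/
def drawingY (a b θ : ℝ) : TreeVertex → ℝ
  | A => a + b
  | B => b
  | C | I => 0
  | D | H => b * θ
  | E | J => 2 * (b * θ)
  | F | K => b - b * θ
  | G | L => b - 2 * (b * θ)

section Drawing

variable {a b μ θ : ℝ}

theorem drawingX_mirrorVertex (v : TreeVertex) :
    drawingX μ θ (mirrorVertex v) = -drawingX μ θ v := by
  cases v <;> simp [drawingX, mirrorVertex]

theorem drawingY_mirrorVertex (v : TreeVertex) :
    drawingY a b θ (mirrorVertex v) = drawingY a b θ v := by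
  cases v <;> rfl

theorem map_mirrorVertex_mirrorVertex (e : Sym2 TreeVertex) :
    (e.map mirrorVertex).map mirrorVertex = e := by
  rw [Sym2.map_map, show mirrorVertex ∘ mirrorVertex = id from funext fun v => by cases v <;> rfl,
    Sym2.map_id, id]

theorem drawingX_neg (hμ : 0 < μ) (hμθ : μ < θ) (hθ : θ < 1 / 8) {v : TreeVertex}
    (hv : v ∈ [C, D, E, F, G]) : drawingX μ θ v < 0 := by
  revert hv
  cases v <;> simp [drawingX] <;> nlinarith [mul_pos hμ (hμ.trans hμθ)]

theorem drawingX_pos (hμ : 0 < μ) (hμθ : μ < θ) (hθ : θ < 1 / 8) {v : TreeVertex}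
    (hv : v ∈ [H, I, J, K, L]) : 0 < drawingX μ θ v := by
  have h : mirrorVertex v ∈ [C, D, E, F, G] := by revert v; decide
  have := drawingX_neg hμ hμθ hθ h
  rwa [drawingX_mirrorVertex, neg_lt_zero] at this

/-- The edges of the drawing are separated in their left-to-right order: an outer edge by its own
line, the two halves of the tree by the vertical axis, and two edges of the interlocked hooks by the
line of one of them. -/
theorem pairwise_separated (ha : 0 < a) (hb : 0 < b) (hμ : 0 < μ) (hμθ : (a + b) * μ < a * θ)
    (hθ : θ < 1 / 8) :
    treeEdges.Pairwise (Separated (drawingX μ θ) (drawingY a b θ)) := by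
  have hμθ' : μ < θ := by nlinarith
  have hθ0 : 0 < θ := hμ.trans hμθ'
  have hbθ : 0 < b * θ := mul_pos hb hθ0
  have hbθ' : b * θ < b / 8 := by nlinarith
  have hbμ : 0 < b * μ := mul_pos hb hμ
  have hbμθ : 0 < b * μ * θ := mul_pos hbμ hθ0
  have hμθ2 : 0 < μ * θ := mul_pos hμ hθ0
  have hneg : ∀ v ∈ [C, D, E, F, G], drawingX μ θ v < 0 := fun v => drawingX_neg hμ hμθ' hθ
  have hpos : ∀ v ∈ [H, I, J, K, L], 0 < drawingX μ θ v := fun v => drawingX_pos hμ hμθ' hθ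
  have hmir : ∀ {e f : Sym2 TreeVertex}, Separated (drawingX μ θ) (drawingY a b θ) e f →
      Separated (drawingX μ θ) (drawingY a b θ) (f.map mirrorVertex) (e.map mirrorVertex) :=
    fun h => h.mirror drawingX_mirrorVertex drawingY_mirrorVertex
  have hAC : ∀ f, Separated (drawingX μ θ) (drawingY a b θ) s(A, C) f := by
    intro f
    rw [Sym2.eq_swap]
    refine Separated.of_left_line (by simp only [drawingY]; linarith) fun w _ hw => ?_
    have hright : ∀ v ∈ [H, I, J, K, L], (drawingX μ θ A - drawingX μ θ C) *
        (drawingY a b θ v - drawingY a b θ C) - (drawingY a b θ A - drawingY a b θ C) *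
        (drawingX μ θ v - drawingX μ θ C) < 0 := by
      intro v hv
      have h1 := mul_pos (add_pos ha hb) (hpos v hv)
      have h2 : drawingY a b θ v ≤ b := by
        revert hv
        cases v <;> simp [drawingY] <;> linarith
      simp only [drawingX, drawingY] at h1 h2 ⊢
      linarith
    cases w
    case A => exact absurd (by decide) hw
    case C => exact absurd (by decide) hw
    case B => simp only [drawingX, drawingY]; linarith
    case D => simp only [drawingX, drawingY]; linarith
    case E =>
      simp only [drawingX, drawingY]
      nlinarith [mul_pos (add_pos ha hb) hμθ2, mul_pos ha hθ0]
    case F => simp only [drawingX, drawingY]; nlinarith [mul_pos (add_pos ha hb) hμ]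
    case G =>
      simp only [drawingX, drawingY]
      nlinarith [mul_pos (add_pos ha hb) (mul_pos hμ (by linarith : 0 < 1 - 2 * θ))]
    case H => exact hright _ (by decide)
    case I => exact hright _ (by decide)
    case J => exact hright _ (by decide)
    case K => exact hright _ (by decide)
    case L => exact hright _ (by decide)
  have hAI : ∀ e, Separated (drawingX μ θ) (drawingY a b θ) e s(A, I) := by
    intro e
    have := hmir (hAC (e.map mirrorVertex))
    rwa [map_mirrorVertex_mirrorVertex] at this
  have hcross : ∀ e f : Sym2 TreeVertex, (∀ v ∈ e, v ∈ [A, B, C, D, E, F, G]) →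
      (∀ v ∈ f, v ∈ [A, B, H, I, J, K, L]) →
      ((∀ v ∈ e, v ∉ f → v ∈ [C, D, E, F, G]) ∨ (∀ v ∈ f, v ∉ e → v ∈ [H, I, J, K, L])) →
      Separated (drawingX μ θ) (drawingY a b θ) e f := by
    intro e f he hf hef
    refine ⟨1, 0, 0, one_pos, fun v hv => ?_, fun v hv => ?_, ?_⟩
    · have h := he v hv
      simp only [zero_mul, zero_add, one_mul]
      rcases List.mem_cons.1 h with rfl | h
      · exact le_rfl
      rcases List.mem_cons.1 h with rfl | h
      · exact le_rfl
      exact (hneg v h).le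
    · have h := hf v hv
      simp only [zero_mul, zero_add, one_mul]
      rcases List.mem_cons.1 h with rfl | h
      · exact le_rfl
      rcases List.mem_cons.1 h with rfl | h
      · exact le_rfl
      exact (hpos v h).le
    · simp only [zero_mul, zero_add, one_mul]
      exact hef.imp (fun h v hv hv' => hneg v (h v hv hv')) fun h v hv hv' => hpos v (h v hv hv')
  have hBD : ∀ v ∈ [C, E, F, G], (drawingX μ θ B - drawingX μ θ D) *
      (drawingY a b θ v - drawingY a b θ D) - (drawingY a b θ B - drawingY a b θ D) *
      (drawingX μ θ v - drawingX μ θ D) < 0 := by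
    intro v hv
    revert hv
    cases v <;> simp [drawingX, drawingY] <;> nlinarith [mul_pos hbμθ hθ0]
  have hEF : ∀ v ∈ [C, D, G], (drawingX μ θ F - drawingX μ θ E) *
      (drawingY a b θ v - drawingY a b θ E) - (drawingY a b θ F - drawingY a b θ E) *
      (drawingX μ θ v - drawingX μ θ E) < 0 := by
    intro v hv
    revert hv
    cases v <;> simp [drawingX, drawingY] <;> nlinarith [mul_pos hbμθ hθ0]
  have hCF : ∀ v ∈ [D, G], 0 < (drawingX μ θ F - drawingX μ θ C) *
      (drawingY a b θ v - drawingY a b θ C) - (drawingY a b θ F - drawingY a b θ C) *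
      (drawingX μ θ v - drawingX μ θ C) := by
    intro v hv
    revert hv
    cases v <;> simp [drawingX, drawingY] <;> nlinarith [mul_pos hbμθ hθ0]
  have hBD' : ∀ f, (∀ v ∈ f, v ∉ s(D, B) → v ∈ [C, E, F, G]) →
      Separated (drawingX μ θ) (drawingY a b θ) s(B, D) f := by
    intro f hf
    rw [Sym2.eq_swap]
    exact Separated.of_left_line (by simp only [drawingY]; linarith)
      fun w hw hw' => hBD w (hf w hw hw')
  have hEF' : ∀ f, (∀ v ∈ f, v ∉ s(E, F) → v ∈ [C, D, G]) →
      Separated (drawingX μ θ) (drawingY a b θ) s(E, F) f := fun f hf =>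
    Separated.of_left_line (by simp only [drawingY]; linarith)
      fun w hw hw' => hEF w (hf w hw hw')
  have hDG' : Separated (drawingX μ θ) (drawingY a b θ) s(D, G) s(C, F) :=
    Separated.of_right_line (by simp only [drawingY]; linarith)
      fun w hw hw' => hCF w ((by decide : ∀ v ∈ s(D, G), v ∈ [D, G]) w hw)
  have h12 := hBD' s(E, F) (by decide)
  have h13 := hBD' s(D, G) (by decide)
  have h14 := hBD' s(C, F) (by decide)
  have h23 := hEF' s(D, G) (by decide)
  have h24 := hEF' s(C, F) (by decide)
  simp only [treeEdges, List.pairwise_cons, List.mem_cons, List.not_mem_nil, or_false,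
    forall_eq_or_imp, forall_eq, IsEmpty.forall_iff, implies_true, List.Pairwise.nil, and_true]
  refine ⟨⟨?_, ?_, ?_, ?_, ?_, ?_, ?_, ?_, ?_, ?_⟩, ⟨h12, h13, h14, ?_, ?_, ?_, ?_, ?_, ?_⟩,
    ⟨h23, h24, ?_, ?_, ?_, ?_, ?_, ?_⟩, ⟨hDG', ?_, ?_, ?_, ?_, ?_, ?_⟩, ⟨?_, ?_, ?_, ?_, ?_, ?_⟩,
    ⟨?_, ?_, ?_, ?_, ?_⟩, ⟨hmir hDG', hmir h24, hmir h14, ?_⟩, ⟨hmir h23, hmir h13, ?_⟩,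
    ⟨hmir h12, ?_⟩, ?_⟩ <;>
  first
  | exact hAC _
  | exact hAI _
  | exact hcross _ _ (by decide) (by decide) (by decide)

theorem eq_of_drawingX_eq_of_drawingY_eq (ha : 0 < a) (hb : 0 < b) (hμ : 0 < μ) (hμθ : μ < θ)
    (hθ : θ < 1 / 8) {u v : TreeVertex} (hx : drawingX μ θ u = drawingX μ θ v)
    (hy : drawingY a b θ u = drawingY a b θ v) : u = v := by
  have hbθ : 0 < b * θ := mul_pos hb (hμ.trans hμθ)
  have hbθ' : b * θ < b / 8 := by nlinarith
  have hC := drawingX_neg hμ hμθ hθ (v := C) (by decide)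
  have hD := drawingX_neg hμ hμθ hθ (v := D) (by decide)
  have hE := drawingX_neg hμ hμθ hθ (v := E) (by decide)
  have hF := drawingX_neg hμ hμθ hθ (v := F) (by decide)
  have hG := drawingX_neg hμ hμθ hθ (v := G) (by decide)
  have hH := drawingX_pos hμ hμθ hθ (v := H) (by decide)
  have hI := drawingX_pos hμ hμθ hθ (v := I) (by decide)
  have hJ := drawingX_pos hμ hμθ hθ (v := J) (by decide)
  have hK := drawingX_pos hμ hμθ hθ (v := K) (by decide)
  have hL := drawingX_pos hμ hμθ hθ (v := L) (by decide)
  cases u <;> cases v <;>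
  first
  | rfl
  | (exfalso; simp only [drawingY] at hy; linarith)

end Drawing

/-- Nontouching drawings of the tree, which converge to the self-touching tree as `θ` tends to `0`.
The offset `θ * (a / (2 * (a + b)))` lies halfway between the bounds at which the vertex `D` would
leave the wedge at `C`. -/
noncomputable def treeDrawing (a b θ : ℝ) (v : TreeVertex) : ℂ :=
  ⟨θ * drawingX (θ * (a / (2 * (a + b)))) θ v, drawingY a b θ v⟩

theorem tendsto_treeDrawing (a b : ℝ) :
    Tendsto (treeDrawing a b) (𝓝[>] 0) (𝓝 (selfTouchingTree a b).1) := by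
  refine tendsto_pi_nhds.2 fun v => ?_
  have hcont : Continuous fun θ => treeDrawing a b θ v := by
    have hre : Continuous fun θ => θ * drawingX (θ * (a / (2 * (a + b)))) θ v := by
      cases v <;> simp only [drawingX] <;> fun_prop
    have him : Continuous fun θ => drawingY a b θ v := by
      cases v <;> simp only [drawingY] <;> fun_prop
    exact Complex.equivRealProdCLM.symm.continuous.comp (hre.prodMk him)
  have h0 : treeDrawing a b 0 v = (selfTouchingTree a b).1 v := by
    refine Complex.ext ?_ ?_
    · simp [treeDrawing, selfTouchingTree]
    · cases v <;> simp [treeDrawing, selfTouchingTree, drawingY, treeHeight]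
  have := hcont.tendsto 0
  rw [h0] at this
  exact this.mono_left nhdsWithin_le_nhds

theorem treeDrawing_separated {a b θ : ℝ} (ha : 0 < a) (hb : 0 < b) (hθ0 : 0 < θ) (hθ : θ < 1 / 8) :
    treeEdges.Pairwise (Separated (fun v => θ * drawingX (θ * (a / (2 * (a + b)))) θ v)
      (drawingY a b θ)) := by
  have hab : 0 < a + b := add_pos ha hb
  refine (pairwise_separated ha hb (by positivity) ?_ hθ).imp fun h => h.scale hθ0
  have : (a + b) * (θ * (a / (2 * (a + b)))) = a * θ / 2 := by field_simp
  rw [this]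
  linarith [mul_pos ha hθ0]

theorem separated_of_idxOf_lt {x y : TreeVertex → ℝ} (h : treeEdges.Pairwise (Separated x y))
    {e f : treeGraph.Dart} (hef : treeEdges.idxOf e.edge < treeEdges.idxOf f.edge) :
    Separated x y e.edge f.edge := by
  have he := List.idxOf_lt_length_of_mem (edge_mem_treeEdges e)
  have hf := List.idxOf_lt_length_of_mem (edge_mem_treeEdges f)
  have := List.pairwise_iff_getElem.1 h _ _ he hf hef
  rwa [List.getElem_idxOf, List.getElem_idxOf] at this

theorem idxOf_lt_or_lt {e f : treeGraph.Dart} (hef : e.edge ≠ f.edge) :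
    treeEdges.idxOf e.edge < treeEdges.idxOf f.edge ∨
      treeEdges.idxOf f.edge < treeEdges.idxOf e.edge :=
  lt_or_gt_of_ne fun h => hef ((List.idxOf_inj (edge_mem_treeEdges e)).1 h)

theorem treeDrawing_isNontouching {a b θ : ℝ} (ha : 0 < a) (hb : 0 < b) (hθ0 : 0 < θ)
    (hθ : θ < 1 / 8) : IsNontouching treeGraph (treeDrawing a b θ) := by
  have hab : 0 < a + b := add_pos ha hb
  have hsep := treeDrawing_separated ha hb hθ0 hθ
  refine ⟨fun u v huv => ?_, ?_⟩
  · have hre := congrArg Complex.re huv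
    have him := congrArg Complex.im huv
    refine eq_of_drawingX_eq_of_drawingY_eq ha hb (by positivity) ?_ hθ
      (mul_left_cancel₀ hθ0.ne' hre) him
    refine mul_lt_of_lt_one_right hθ0 ((div_lt_one (by positivity)).2 (by linarith))
  · rintro e f hef z ⟨hze, hzf⟩
    rcases idxOf_lt_or_lt hef with h | h
    · exact (separated_of_idxOf_lt hsep h).exists_common_vertex hef (fun _ => rfl) hze hzf
    · obtain ⟨v, hv, hv', hvz⟩ :=
        (separated_of_idxOf_lt hsep h).exists_common_vertex hef.symm (fun _ => rfl) hzf hze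
      exact ⟨v, hv', hv, hvz⟩

theorem eventually_treeDrawing_onSide {a b : ℝ} (ha : 0 < a) (hb : 0 < b) {e f : treeGraph.Dart}
    (hef : e.edge ≠ f.edge) : ∀ᶠ θ in 𝓝[>] (0 : ℝ),
      OnSide (treeSide a b e f) (treeDrawing a b θ f.fst) (treeDrawing a b θ f.snd)
        (treeDrawing a b θ e.fst) (treeDrawing a b θ e.snd) := by
  set σ : ℝ := if treeHeight a b f.fst < treeHeight a b f.snd then 1 else -1 with hσ
  have him : ∀ v, Tendsto (fun θ => (treeDrawing a b θ v).im) (𝓝[>] 0)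
      (𝓝 (treeHeight a b v)) := fun v => by
    simpa [Function.comp_def, selfTouchingTree] using
      (Complex.continuous_im.tendsto _).comp (tendsto_pi_nhds.1 (tendsto_treeDrawing a b) v)
  have hpos : 0 < σ * (treeHeight a b f.snd - treeHeight a b f.fst) := by
    rw [hσ]
    split_ifs with h
    · linarith
    · have := lt_of_le_of_ne (not_lt.1 h) (treeHeight_ne ha hb f.adj).symm
      linarith
  have hev := (((him f.snd).sub (him f.fst)).const_mul σ).eventually_const_lt hpos
  filter_upwards [hev, Ioo_mem_nhdsGT (by norm_num : (0 : ℝ) < 1 / 8)] with θ h ⟨h1, h2⟩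
  have hn := treeDrawing_isNontouching ha hb h1 h2
  have hsep := treeDrawing_separated ha hb h1 h2
  rcases idxOf_lt_or_lt hef with hlt | hlt
  · rw [treeSide, if_pos hlt, one_mul]
    exact (separated_of_idxOf_lt hsep hlt).onSide_left (fun _ => rfl) hn hef h
  · rw [treeSide, if_neg hlt.asymm, neg_one_mul]
    exact (separated_of_idxOf_lt hsep hlt).onSide_right (fun _ => rfl) hn hef h

theorem selfTouchingTree_mem_selfTouchingSpace {a b : ℝ} (ha : 0 < a) (hb : 0 < b) :
    selfTouchingTree a b ∈ (treeLinkage a b ha hb).selfTouchingSpace := by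
  refine ⟨selfTouchingTree_realizes ha hb, ?_⟩
  have hlim : Tendsto (fun θ => annotate treeGraph (treeDrawing a b θ)) (𝓝[>] 0)
      (𝓝 (selfTouchingTree a b)) := by
    refine (tendsto_treeDrawing a b).prodMk_nhds ?_
    refine tendsto_pi_nhds.2 fun e => tendsto_pi_nhds.2 fun f => ?_
    change Tendsto (fun θ => sideAnnotation treeGraph (treeDrawing a b θ) e f) _
      (𝓝 (treeAnnotation a b e f))
    by_cases hef : e.edge = f.edge
    · simp [sideAnnotation, treeAnnotation, hef]
    · rw [treeAnnotation_eq a b hef]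
      exact tendsto_sideAnnotation ha hb (tendsto_treeDrawing a b) hef (treeSide_eq a b e f)
        fun _ => eventually_treeDrawing_onSide ha hb hef
  refine mem_closure_of_tendsto hlim ?_
  filter_upwards [Ioo_mem_nhdsGT (by norm_num : (0 : ℝ) < 1 / 8)] with θ ⟨h1, h2⟩
  exact ⟨_, treeDrawing_isNontouching ha hb h1 h2, rfl⟩

end SelfTouching

theorem mainTheorem3 (a b : ℝ) (ha : 0 < a) (hb : 0 < b) :
    SelfTouching.selfTouchingTree a b ∈
        (SelfTouching.treeLinkage a b ha hb).selfTouchingSpace ∧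
      (SelfTouching.treeLinkage a b ha hb).IsRigid (SelfTouching.selfTouchingTree a b) :=
  ⟨SelfTouching.selfTouchingTree_mem_selfTouchingSpace ha hb,
    SelfTouching.selfTouchingTree_isRigid ha hb⟩
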